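/- \textbf{Setting.} Let $d,k,N\ge 1$. A Markovian jump linear system has state matrices $A_i\in\mathbb R^{d\times d}$, input matrices $B_i\in\mathbb R^{d\times k}$ and cost matrices $Q_i\succ0$, $R_i\succ 0$ ($1\le i\le N$), a mode process $\omega(0),\omega(1),\dots$ which is a time-homogeneous Markov chain on $\{1,\dots,N\}$ with transition probabilities $p_{ij}$ and initial law $\pi$, $\pi_i>0$, and an initial state $x_0\sim\mathcal D$ independent of the mode process, with $\mathcal D$ a probability law on $\mathbb R^d$. A policy $K=(K_1,\dots,K_N)$, $K_i\in\mathbb R^{k\times d}$, produces $$x_{t+1}=A_{\omega(t)}x_t+B_{\omega(t)}u_t,\qquad u_t=-K_{\omega(t)}x_t,$$ with cost $C(K)=\mathbb E\sum_{t\ge0}\big(x_t^\top Q_{\omega(t)}x_t+u_t^\top R_{\omega(t)}u_t\big)\in[0,\infty]$ and state correlation $X^K=(X^K_1,\dots,X^K_N)$, $X_i^K=\sum_{t\ge0}\mathbb E[x_tx_t^\top\mathbf 1_{\omega(t)=i}]$. Write $\|\cdot\|$ for the Euclidean and the spectral norm, $\|V\|=\sum_{i}\|V_i\|$ for a tuple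 of $d\times d$ matrices, $\Lambda_{\min}(V)=\min_i\sigma_{\min}(V_i)$, and $\mu=\min_i\pi_i\,\sigma_{\min}(\mathbb E[x_0x_0^\top])$. \textbf{Estimator.} For $r>0$ and $\ell,m\in\mathbb N$, run $m$ independent rollouts. In rollout $j$ draw $U_j$ uniformly from the $k\times d$ matrices of Frobenius norm $r$, and independently of it $x_0^j\sim\mathcal D$ and a mode process $\omega^j$; let $x^j_t$ be the resulting trajectory of the policy $(K_1+U_j,\dots,K_N+U_j)$. Put $$\widetilde X^K_p=\frac1m\sum_{j=1}^m\sum_{t=0}^{\ell-1}x^j_t(x^j_t)^\top\mathbf 1_{\omega^j(t)=p},\qquad p=1,\dots,N.$$ \textbf{Lemma.} For every $M>0$ there are real polynomials $f_{r}(y)$ (positive for $y>0$), $f_{\ell}(y_1,y_2)$ and $f_{s}(y_1,y_2,y_3)$, depending only on $M$, with the following property. For all $d,k,N\ge1$ and every system and policy $K$ as above with $$\max_i\|B_i\|\le M,\quad \max_i\|A_i-B_iK_i\|\le M,\quad C(K)\le M,\quad \Lambda_{\min}(Q)\ge \tfrac1M,\quad \mu\ge\tfrac1M,$$ every $L$ with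 $\|x_0\|\le L$ almost surely, every $\varepsilon>0$, and all $$0<r\le \frac1{f_{r}(1/\varepsilon)},\qquad \ell\ge f_{\ell}(d,1/\varepsilon),\qquad m\ge f_{s}(d,1/\varepsilon,L^2/\mu),$$ one has, with probability at least $1-(d/\varepsilon)^{-d}$, $$\|\widetilde X^K-X^K\|\le\varepsilon .$$ In particular, for a fixed system and a fixed policy $K$ with $C(K)<\infty$ and $\mu>0$ such polynomials exist. -/

import Mathlib

open MeasureTheory ProbabilityTheory
open scoped Matrix Matrix.Norms.L2Operator

/-- Data of a Markovian jump linear system with quadratic cost: state dimension `d`, input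
dimension `k`, modes `Fin N`.  The `(i, j)` transition probability is `trans i j`, the law of the
initial mode is `init`, and the law of the initial state is `D`. -/
structure MJLS (d k N : ℕ) where
  A : Fin N → Matrix (Fin d) (Fin d) ℝ
  B : Fin N → Matrix (Fin d) (Fin k) ℝ
  Q : Fin N → Matrix (Fin d) (Fin d) ℝ
  R : Fin N → Matrix (Fin k) (Fin k) ℝ
  trans : Fin N → PMF (Fin N)
  init : PMF (Fin N)
  D : Measure (EuclideanSpace ℝ (Fin d))
  Q_posDef : ∀ i, (Q i).PosDef
  R_posDef : ∀ i, (R i).PosDef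
  init_pos : ∀ i, 0 < init i
  isProb : IsProbabilityMeasure D

/-- The (mode-dependent) linear policies `K = (K_1, …, K_N)`, acting by `u = - K_i x` in mode `i`. -/
abbrev Policy (d k N : ℕ) := Fin N → Matrix (Fin k) (Fin d) ℝ

/-- Smallest singular value of a square matrix: the minimum of `‖V v‖` over unit vectors `v`. -/
noncomputable def sigmaMin {d : ℕ} (V : Matrix (Fin d) (Fin d) ℝ) : ℝ :=
  ⨅ v : Metric.sphere (0 : EuclideanSpace ℝ (Fin d)) 1, ‖Matrix.toEuclideanCLM (𝕜 := ℝ) V v‖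

/-- `Λ_min(V) = min_i σ_min(V_i)`. -/
noncomputable def lambdaMin {d N : ℕ} (V : Fin N → Matrix (Fin d) (Fin d) ℝ) : ℝ :=
  ⨅ i, sigmaMin (V i)

/-- The norm `∑_i ‖V_i‖` (spectral norms) of a tuple of matrices. -/
noncomputable def tupleNorm {d N : ℕ} (V : Fin N → Matrix (Fin d) (Fin d) ℝ) : ℝ :=
  ∑ i, ‖V i‖

/-- The outer product `x xᵀ`. -/
def outer {d : ℕ} (x : Fin d → ℝ) : Matrix (Fin d) (Fin d) ℝ := Matrix.vecMulVec x x

/-- The uniform distribution on the matrices in `ℝ^{k × d}` of Frobenius norm `r`; a matrix is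
written as the Euclidean vector of its entries. -/
noncomputable def sphereLaw (d k : ℕ) (r : ℝ) : Measure (EuclideanSpace ℝ (Fin k × Fin d)) :=
  (((volume : Measure (EuclideanSpace ℝ (Fin k × Fin d))).toSphere Set.univ)⁻¹ •
    (volume : Measure (EuclideanSpace ℝ (Fin k × Fin d))).toSphere).map
      (fun u : Metric.sphere (0 : EuclideanSpace ℝ (Fin k × Fin d)) 1 => r • u.1)

/-- The matrix with the given entries. -/
def toMat {d k : ℕ} (u : EuclideanSpace ℝ (Fin k × Fin d)) : Matrix (Fin k) (Fin d) ℝ :=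
  Matrix.of fun a b => u (a, b)

namespace MJLS

variable {d k N : ℕ} (S : MJLS d k N)

/-- One-step transition kernel of the mode process, as a function of the past. -/
noncomputable def modeKernel (n : ℕ) : Kernel (Finset.Iic n → Fin N) (Fin N) :=
  Kernel.ofFunOfCountable fun past => (S.trans (past ⟨n, Finset.mem_Iic.2 le_rfl⟩)).toMeasure

instance (n : ℕ) : IsMarkovKernel (S.modeKernel n) :=
  ⟨fun past => PMF.toMeasure.isProbabilityMeasure (S.trans (past ⟨n, Finset.mem_Iic.2 le_rfl⟩))⟩

/-- Law of the mode process `ω(0), ω(1), …`: the time homogeneous Markov chain with initial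
distribution `init` and transition probabilities `trans`. -/
noncomputable def modeLaw : Measure (ℕ → Fin N) :=
  Kernel.trajMeasure (X := fun _ => Fin N) S.init.toMeasure S.modeKernel

/-- Joint law of the initial state and the mode process, which are independent. -/
noncomputable def baseLaw : Measure (EuclideanSpace ℝ (Fin d) × (ℕ → Fin N)) :=
  S.D.prod S.modeLaw

/-- The state `x_t` under `x_{t+1} = A_{ω(t)} x_t + B_{ω(t)} u_t`, `u_t = - K_{ω(t)} x_t`, started
from the state `z.1` and driven by the modes `ω = z.2`. -/
def state (K : Policy d k N) (z : EuclideanSpace ℝ (Fin d) × (ℕ → Fin N)) : ℕ → Fin d → ℝ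
  | 0 => z.1.ofLp
  | t + 1 => S.A (z.2 t) *ᵥ state K z t + S.B (z.2 t) *ᵥ (-(K (z.2 t) *ᵥ state K z t))

/-- The stage cost `x_tᵀ Q_{ω(t)} x_t + u_tᵀ R_{ω(t)} u_t` with `u_t = - K_{ω(t)} x_t`. -/
def stageCost (K : Policy d k N) (z : EuclideanSpace ℝ (Fin d) × (ℕ → Fin N)) (t : ℕ) : ℝ :=
  S.state K z t ⬝ᵥ (S.Q (z.2 t) *ᵥ S.state K z t) +
    (-(K (z.2 t) *ᵥ S.state K z t)) ⬝ᵥ (S.R (z.2 t) *ᵥ (-(K (z.2 t) *ᵥ S.state K z t)))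

/-- The cost `C(K)`, with values in `[0, ∞]`. -/
noncomputable def cost (K : Policy d k N) : ENNReal :=
  ∫⁻ z, ∑' t, ENNReal.ofReal (S.stageCost K z t) ∂S.baseLaw

/-- `X_i(t) = E[x_t x_tᵀ 1_{ω(t) = i}]`. -/
noncomputable def corrAt (K : Policy d k N) (t : ℕ) (i : Fin N) : Matrix (Fin d) (Fin d) ℝ :=
  ∫ z, (if z.2 t = i then outer (S.state K z t) else 0) ∂S.baseLaw

/-- The state correlation `X^K`, with components `∑_{t ≥ 0} X_i(t)`. -/
noncomputable def corr (K : Policy d k N) (i : Fin N) : Matrix (Fin d) (Fin d) ℝ :=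
  ∑' t, S.corrAt K t i

/-- `μ = Λ_min(X(0))` with `X_i(0) = π_i E[x_0 x_0ᵀ]`, that is `μ = min_i π_i σ_min(E[x_0 x_0ᵀ])`. -/
noncomputable def mu : ℝ :=
  lambdaMin fun i => (S.init i).toReal • ∫ x, outer x.ofLp ∂S.D

/-- Law of the randomness in one rollout: a perturbation `U`, uniform on the Frobenius sphere of
radius `r`, and independently of it an initial state and a mode process. -/
noncomputable def rolloutLaw (r : ℝ) :
    Measure (EuclideanSpace ℝ (Fin k × Fin d) × EuclideanSpace ℝ (Fin d) × (ℕ → Fin N)) :=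
  (sphereLaw d k r).prod S.baseLaw

/-- The estimate `X̃^K`, with components `(1/m) ∑_{j < m} ∑_{t < ℓ} x^j_t (x^j_t)ᵀ 1_{ω^j(t) = i}`;
the rollout `j` uses the policy `(K_1 + U_j, …, K_N + U_j)`. -/
noncomputable def corrEst (K : Policy d k N) (l m : ℕ)
    (s : Fin m → EuclideanSpace ℝ (Fin k × Fin d) × EuclideanSpace ℝ (Fin d) × (ℕ → Fin N))
    (i : Fin N) : Matrix (Fin d) (Fin d) ℝ :=
  (1 / (m : ℝ)) • ∑ j, ∑ t ∈ Finset.range l,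
    if (s j).2.2 t = i then outer (S.state (fun p => K p + toMat (s j).1) (s j).2 t) else 0

end MJLS

/-! The finite-horizon cost-to-go matrices P_n(i) serve as a Lyapunov function. With Σ = E[x_0
x_0ᵀ], the cost bound gives ∑ π_i tr(P_n(i) Σ) ≤ M. Since π_i Σ ≥ I/M, it follows that tr P_n(i) ≤
M² for every horizon n, while P_{n+1}(i) ≥ Q_i ≥ I/M. By the Bellman recursion one closed-loop step
contracts the form by 1 - 1/M³ while the horizon drops from n+1 to n, and a gain perturbation of
size at most 1/(4M⁶) still leaves the rate ρ = 1 - 1/(4M³) (`contraction`). Hence E‖x_t‖² ≤ M⁵ρ^t,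
uniformly over the sampled policies and without passing to a limit of P_n.

The same trace inequalities give N d ≤ M³ (`card_mul_dim_le`), so N d is bounded by a constant D
depending on M alone. For ε < d the allowed failure probability (ε/d)^d is then at least (ε/D)^D,
whose inverse is polynomial in 1/ε. This is why Chebyshev, Markov and a union bound over the N d²
entries suffice.

The rollout length ℓ is bounded only from below, and the pathwise bound on the state grows like
(2M)^t. The sum is therefore split at a time T independent of ℓ. Before T, the perturbation bias is
at most 2r(8M²)^T M², and Chebyshev applies to a variable bounded by (8M²)^T L². After T, Markov
applies to a nonnegative tail of mean at most 4M⁸ρ^T. Choosing T as the first time at which ρ^T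
falls below a threshold makes (8M²)^T polynomial in 1/ε (`exists_pow_le_and_pow_le`). -/

namespace Matrix

/-! ### Quadratic forms, traces and norms of matrices -/

variable {m n : Type*} [Fintype n]

lemma PosSemidef.dotProduct_mulVec_nonneg' {P : Matrix n n ℝ} (hP : P.PosSemidef) (x : n → ℝ) :
    0 ≤ x ⬝ᵥ P *ᵥ x := by
  simpa using hP.dotProduct_mulVec_nonneg x

open scoped MatrixOrder in
lemma PosSemidef.trace_mul_nonneg [DecidableEq n] {P V : Matrix n n ℝ} (hP : P.PosSemidef)
    (hV : V.PosSemidef) : 0 ≤ (P * V).trace := by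
  obtain ⟨C, rfl⟩ := CStarAlgebra.nonneg_iff_eq_star_mul_self.mp hP.nonneg
  rw [star_eq_conjTranspose, Matrix.mul_assoc, Matrix.trace_mul_comm]
  exact (hV.mul_mul_conjTranspose_same C).trace_nonneg

lemma trace_mul_vecMulVec_self (P : Matrix n n ℝ) (x : n → ℝ) :
    (P * vecMulVec x x).trace = x ⬝ᵥ P *ᵥ x := by
  rw [mul_vecMulVec, trace_vecMulVec, dotProduct_comm]

lemma dotProduct_sq_le (x y : n → ℝ) : (x ⬝ᵥ y) ^ 2 ≤ (x ⬝ᵥ x) * (y ⬝ᵥ y) := by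
  simpa [dotProduct, sq] using Finset.sum_mul_sq_le_sq_mul_sq Finset.univ x y

lemma posSemidef_of_isHermitian_of_nonneg {P : Matrix n n ℝ} (h : P.IsHermitian)
    (hP : ∀ x, 0 ≤ x ⬝ᵥ P *ᵥ x) : P.PosSemidef :=
  PosSemidef.of_dotProduct_mulVec_nonneg h (by simpa using hP)

/-- By Cauchy–Schwarz x xᵀ ≤ (xᵀx) I, and taking the trace against a positive semidefinite P
preserves the order. -/
lemma PosSemidef.dotProduct_mulVec_le_trace [DecidableEq n] {P : Matrix n n ℝ} (hP : P.PosSemidef) (x : n → ℝ) :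
    x ⬝ᵥ P *ᵥ x ≤ P.trace * (x ⬝ᵥ x) := by
  have hV : ((x ⬝ᵥ x) • (1 : Matrix n n ℝ) - vecMulVec x x).PosSemidef := by
    refine posSemidef_of_isHermitian_of_nonneg ?_ fun y => ?_
    · ext i j
      simp [vecMulVec_apply, mul_comm, one_apply, eq_comm]
    · rw [sub_mulVec, dotProduct_sub, smul_mulVec, one_mulVec, vecMulVec_mulVec]
      have := dotProduct_sq_le x y
      simp only [dotProduct_smul, smul_eq_mul, op_smul_eq_smul]
      rw [dotProduct_comm y x]
      nlinarith
  have := hP.trace_mul_nonneg hV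
  rw [Matrix.mul_sub, trace_sub, trace_mul_vecMulVec_self, Matrix.mul_smul, Matrix.mul_one,
    trace_smul, smul_eq_mul] at this
  linarith

/-- Young's inequality: expand the form at `s • a - b` and divide by `s`. Both cross terms are kept,
so `P` need not be symmetric. -/
lemma dotProduct_mulVec_add_le {P : Matrix n n ℝ} (hP : ∀ x, 0 ≤ x ⬝ᵥ P *ᵥ x) (a b : n → ℝ)
    {s : ℝ} (hs : 0 < s) :
    (a + b) ⬝ᵥ P *ᵥ (a + b) ≤ (1 + s) * (a ⬝ᵥ P *ᵥ a) + (1 + 1 / s) * (b ⬝ᵥ P *ᵥ b) := by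
  have h := hP (s • a - b)
  simp only [mulVec_sub, mulVec_add, dotProduct_add, dotProduct_sub, add_dotProduct,
    sub_dotProduct, mulVec_smul, dotProduct_smul, smul_dotProduct, smul_eq_mul] at h ⊢
  have h2 : 0 ≤ (s * (s * (a ⬝ᵥ P *ᵥ a)) - s * (b ⬝ᵥ P *ᵥ a) -
    (s * (a ⬝ᵥ P *ᵥ b) - b ⬝ᵥ P *ᵥ b)) / s := div_nonneg (by linarith) hs.le
  have h3 : (s * (s * (a ⬝ᵥ P *ᵥ a)) - s * (b ⬝ᵥ P *ᵥ a) -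
    (s * (a ⬝ᵥ P *ᵥ b) - b ⬝ᵥ P *ᵥ b)) / s = s * (a ⬝ᵥ P *ᵥ a) - b ⬝ᵥ P *ᵥ a -
      a ⬝ᵥ P *ᵥ b + 1 / s * (b ⬝ᵥ P *ᵥ b) := by field_simp; ring
  linarith

lemma dotProduct_transpose_mul_mul_mulVec [Fintype m] (P : Matrix m m ℝ) (F : Matrix m n ℝ) (x : n → ℝ) :
    x ⬝ᵥ (Fᵀ * P * F) *ᵥ x = (F *ᵥ x) ⬝ᵥ P *ᵥ (F *ᵥ x) := by
  rw [← mulVec_mulVec, ← mulVec_mulVec, dotProduct_mulVec, vecMul_transpose]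

lemma sum_mulVec' {ι : Type*} (s : Finset ι) (P : ι → Matrix m n ℝ) (x : n → ℝ) :
    (∑ i ∈ s, P i) *ᵥ x = ∑ i ∈ s, P i *ᵥ x := by
  ext a
  simp only [mulVec, dotProduct, Finset.sum_apply, Matrix.sum_apply, Finset.sum_mul]
  exact Finset.sum_comm

lemma dotProduct_self_nonneg' (x : n → ℝ) : 0 ≤ x ⬝ᵥ x := by
  simpa using dotProduct_star_self_nonneg x

lemma norm_toLp_mulVec_le [Fintype m] [DecidableEq n] (A : Matrix m n ℝ) (x : n → ℝ) :
    ‖WithLp.toLp 2 (A *ᵥ x)‖ ≤ ‖A‖ * ‖WithLp.toLp 2 x‖ :=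
  A.l2_opNorm_mulVec (WithLp.toLp 2 x)

lemma norm_toLp_sq (x : n → ℝ) : ‖WithLp.toLp 2 x‖ ^ 2 = x ⬝ᵥ x := by
  rw [EuclideanSpace.real_norm_sq_eq]
  simp [dotProduct, sq]

lemma l2_opNorm_le_sum_abs [Fintype m] [DecidableEq m] [DecidableEq n] (A : Matrix m n ℝ) : ‖A‖ ≤ ∑ i, ∑ j, |A i j| := by
  conv_lhs => rw [matrix_eq_sum_single A]
  refine (norm_sum_le _ _).trans (Finset.sum_le_sum fun i _ => (norm_sum_le _ _).trans
    (Finset.sum_le_sum fun j _ => ?_))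
  rw [l2_opNorm_def]
  refine ContinuousLinearMap.opNorm_le_bound _ (abs_nonneg _) fun x => ?_
  have : WithLp.toLp 2 (single i j (A i j) *ᵥ x.ofLp) =
      EuclideanSpace.single i (A i j * x j) := by
    ext a
    simp [single_mulVec, Function.update_apply]
  change ‖WithLp.toLp 2 (single i j (A i j) *ᵥ x.ofLp)‖ ≤ _
  rw [this, PiLp.norm_single, Real.norm_eq_abs, abs_mul]
  gcongr
  exact PiLp.norm_apply_le x j

/-- Expanding in matrix units reduces the Bochner integral to scalar ones, so only the entries have
to be integrable. -/
lemma integral_apply {Ω : Type*} [MeasurableSpace Ω] {P : Measure Ω} [Fintype m]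
    [DecidableEq m] [DecidableEq n]
    {f : Ω → Matrix m n ℝ} (hf : ∀ a b, Integrable (fun z => f z a b) P) (a : m) (b : n) :
    (∫ z, f z ∂P) a b = ∫ z, f z a b ∂P := by
  have : ∀ z, f z = ∑ i, ∑ j, f z i j • single i j (1 : ℝ) := fun z => by
    conv_lhs => rw [matrix_eq_sum_single (f z)]
    simp
  have hi : ∀ i j, Integrable (fun z => f z i j • single i j (1 : ℝ)) P :=
    fun i j => (hf i j).smul_const _
  conv_lhs => rw [integral_congr_ae (ae_of_all P this)]
  rw [integral_finsetSum _ fun i _ => integrable_finsetSum _ fun j _ => hi i j]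
  simp_rw [integral_finsetSum _ fun j _ => hi _ j, integral_smul_const]
  simp [Matrix.sum_apply, single_apply, ite_and]

end Matrix

open Matrix

/-! ### Smallest singular values and the Frobenius norm -/

lemma sigmaMin_le_norm {d : ℕ} (V : Matrix (Fin d) (Fin d) ℝ) (v : EuclideanSpace ℝ (Fin d))
    (hv : ‖v‖ = 1) : sigmaMin V ≤ ‖Matrix.toEuclideanCLM (𝕜 := ℝ) V v‖ :=
  ciInf_le (f := fun v : Metric.sphere (0 : EuclideanSpace ℝ (Fin d)) 1 =>
    ‖Matrix.toEuclideanCLM (𝕜 := ℝ) V v‖) ⟨0, by rintro _ ⟨v, rfl⟩; exact norm_nonneg _⟩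
    ⟨v, by simpa using hv⟩

lemma lambdaMin_le {d N : ℕ} (V : Fin N → Matrix (Fin d) (Fin d) ℝ) (i : Fin N) :
    lambdaMin V ≤ sigmaMin (V i) :=
  ciInf_le (Set.finite_range _).bddBelow i

/-- A positive semidefinite matrix dominates its smallest singular value. -/
lemma Matrix.PosSemidef.sub_smul_one {d : ℕ} {V : Matrix (Fin d) (Fin d) ℝ} (hV : V.PosSemidef)
    {c : ℝ} (hc : c ≤ sigmaMin V) : (V - c • (1 : Matrix (Fin d) (Fin d) ℝ)).PosSemidef := by
  have hH : (V - c • (1 : Matrix (Fin d) (Fin d) ℝ)).IsHermitian :=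
    hV.isHermitian.sub (by ext i j; simp [one_apply, eq_comm])
  rw [hH.posSemidef_iff_eigenvalues_nonneg]
  intro i
  -- An eigenvector of V - c with eigenvalue λ is one of V with eigenvalue λ + c ≥ 0, so λ + c = ‖V
  -- w‖ ≥ σ_min(V) ≥ c.
  set w := hH.eigenvectorBasis i
  have hw : ‖w‖ = 1 := hH.eigenvectorBasis.orthonormal.1 i
  have hVw : V *ᵥ w.ofLp = (hH.eigenvalues i + c) • w.ofLp := by
    have h := hH.mulVec_eigenvectorBasis i
    rw [sub_mulVec, smul_mulVec, one_mulVec, sub_eq_iff_eq_add] at h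
    rw [add_smul]; exact h
  have h1 : 0 ≤ hH.eigenvalues i + c := by
    have h := hV.dotProduct_mulVec_nonneg' w.ofLp
    have hw2 : w.ofLp ⬝ᵥ w.ofLp = 1 := by
      rw [← norm_toLp_sq]; change ‖w‖ ^ 2 = 1; rw [hw, one_pow]
    rwa [hVw, dotProduct_smul, hw2, smul_eq_mul, mul_one] at h
  have h2 := hc.trans (sigmaMin_le_norm V w hw)
  have h3 : Matrix.toEuclideanCLM (𝕜 := ℝ) V w = (hH.eigenvalues i + c) • w := by
    change WithLp.toLp 2 (V *ᵥ w.ofLp) = _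
    rw [hVw]; rfl
  rw [h3, norm_smul, hw, Real.norm_of_nonneg h1] at h2
  change 0 ≤ hH.eigenvalues i
  linarith

/-- Cauchy–Schwarz in each row: the Frobenius norm dominates the spectral norm. -/
lemma norm_toMat_mulVec_le {d k : ℕ} (u : EuclideanSpace ℝ (Fin k × Fin d)) (x : Fin d → ℝ) :
    ‖WithLp.toLp 2 (toMat u *ᵥ x)‖ ≤ ‖u‖ * ‖WithLp.toLp 2 x‖ := by
  refine le_of_sq_le_sq ?_ (by positivity)
  rw [mul_pow, norm_toLp_sq x, norm_toLp_sq (toMat u *ᵥ x), EuclideanSpace.real_norm_sq_eq u, Fintype.sum_prod_type,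
    Finset.sum_mul]
  refine Finset.sum_le_sum fun a _ => ?_
  have := dotProduct_sq_le (toMat u a) x
  simpa [dotProduct, toMat, mulVec, sq] using this

/-! ### Closed-loop dynamics, Markov property, measurability -/

namespace MJLS

variable {d k N : ℕ} (S : MJLS d k N)

/-- The closed-loop matrices `A_i - B_i K_i`. -/
def closedLoop (K : Policy d k N) (i : Fin N) : Matrix (Fin d) (Fin d) ℝ :=
  S.A i - S.B i * K i

lemma state_succ (K : Policy d k N) (z : EuclideanSpace ℝ (Fin d) × (ℕ → Fin N)) (t : ℕ) :
    S.state K z (t + 1) = S.closedLoop K (z.2 t) *ᵥ S.state K z t := by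
  rw [closedLoop, sub_mulVec, sub_eq_add_neg, ← mulVec_mulVec]
  simp [state, mulVec_neg]

lemma closedLoop_add (K : Policy d k N) (U : Matrix (Fin k) (Fin d) ℝ) (i : Fin N) :
    S.closedLoop (fun p => K p + U) i = S.closedLoop K i - S.B i * U := by
  simp [closedLoop, Matrix.mul_add, sub_sub]

lemma closedLoop_add_mulVec (K : Policy d k N) (U : Matrix (Fin k) (Fin d) ℝ) (i : Fin N)
    (x : Fin d → ℝ) :
    S.closedLoop (fun p => K p + U) i *ᵥ x = S.closedLoop K i *ᵥ x + -(S.B i *ᵥ (U *ᵥ x)) := by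
  rw [closedLoop_add, sub_mulVec, mulVec_mulVec, sub_eq_add_neg]

/-- The state at time `t` only depends on the modes at times `< t`. -/
lemma state_congr (K : Policy d k N) (x : EuclideanSpace ℝ (Fin d)) {w w' : ℕ → Fin N} {t : ℕ}
    (h : ∀ s < t, w s = w' s) : S.state K (x, w) t = S.state K (x, w') t := by
  induction t with
  | zero => rfl
  | succ t ih =>
    rw [state_succ, state_succ, ih fun s hs => h s (hs.trans t.lt_succ_self)]
    simp [h t t.lt_succ_self]

instance : IsProbabilityMeasure S.D := S.isProb

instance : IsProbabilityMeasure S.init.toMeasure := PMF.toMeasure.isProbabilityMeasure _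

instance : IsProbabilityMeasure S.modeLaw := by unfold modeLaw; infer_instance

instance : IsProbabilityMeasure S.baseLaw := by unfold baseLaw; infer_instance

/-- The Markov property, one step ahead. -/
lemma lintegral_modeLaw_succ (t : ℕ) (f : Fin N → (ℕ → Fin N) → ENNReal)
    (hf : ∀ j w w', (∀ s ≤ t, w s = w' s) → f j w = f j w') :
    ∫⁻ w, f (w (t + 1)) w ∂S.modeLaw =
      ∫⁻ w, ∑ j, S.trans (w t) j * f j w ∂S.modeLaw := by
  classical
  -- The integrand sees only times up to `t`, so any extension of a past to a full path will do. It
  -- becomes a function on a finite space, where measurability is automatic.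
  let ext : (Finset.Iic t → Fin N) → ℕ → Fin N :=
    fun p s => if h : s ≤ t then p ⟨s, Finset.mem_Iic.2 h⟩ else p ⟨t, Finset.mem_Iic.2 le_rfl⟩
  have hext : ∀ j w, f j w = f j (ext (Preorder.frestrictLe t w)) := fun j w =>
    hf j _ _ fun s hs => by simp [ext, hs]
  have key := Kernel.map_frestrictLe_trajMeasure_compProd_eq_map_trajMeasure
    (X := fun _ => Fin N) (μ₀ := S.init.toMeasure) (κ := S.modeKernel) (a := t)
  let g : (Finset.Iic t → Fin N) × Fin N → ENNReal := fun q => f q.2 (ext q.1)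
  have hg : Measurable g := measurable_of_countable g
  have hL : ∫⁻ w, f (w (t + 1)) w ∂S.modeLaw =
      ∫⁻ q, g q ∂(S.modeLaw.map (fun w => (Preorder.frestrictLe t w, w (t + 1)))) := by
    rw [lintegral_map hg (by fun_prop)]
    exact lintegral_congr fun w => hext _ _
  rw [hL]
  unfold modeLaw
  rw [← key, Measure.lintegral_compProd hg, lintegral_map (measurable_of_countable _) (by fun_prop)]
  refine lintegral_congr fun w => ?_
  have : S.modeKernel t (Preorder.frestrictLe t w) = (S.trans (w t)).toMeasure := rfl
  rw [this, lintegral_fintype]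
  refine Finset.sum_congr rfl fun j _ => ?_
  rw [PMF.toMeasure_apply_singleton _ _ (measurableSet_singleton j), mul_comm, hext j w]

lemma lintegral_modeLaw_zero (f : Fin N → ENNReal) :
    ∫⁻ w, f (w 0) ∂S.modeLaw = ∑ i, S.init i * f i := by
  have h : S.modeLaw.map (fun w => w 0) = S.init.toMeasure := by
    have h0 : (fun w : ℕ → Fin N => w 0) =
        (fun p : Finset.Iic 0 → Fin N => p ⟨0, Finset.mem_Iic.2 le_rfl⟩) ∘
          Preorder.frestrictLe (π := fun _ => Fin N) 0 := rfl
    rw [h0, ← Measure.map_map (by fun_prop) (by fun_prop)]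
    unfold modeLaw Kernel.trajMeasure
    rw [Measure.map_comp _ _ (by fun_prop), Kernel.traj_map_frestrictLe, Kernel.partialTraj_self,
      Measure.id_comp, Measure.map_map (by fun_prop) (by fun_prop)]
    exact Measure.map_id
  rw [← lintegral_map (g := fun w : ℕ → Fin N => w 0) (measurable_of_countable f) (by fun_prop), h,
    lintegral_fintype]
  refine Finset.sum_congr rfl fun j _ => ?_
  rw [PMF.toMeasure_apply_singleton _ _ (measurableSet_singleton j), mul_comm]

lemma measurable_closedLoop_apply {α : Type*} [MeasurableSpace α] {K : α → Policy d k N}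
    {w : α → Fin N} (hK : ∀ i a b, Measurable fun s => K s i a b) (hw : Measurable w)
    (a b : Fin d) : Measurable fun s => S.closedLoop (K s) (w s) a b := by
  have h1 : ∀ i, Measurable fun s => S.closedLoop (K s) i a b := fun i => by
    simp only [closedLoop, Matrix.sub_apply, Matrix.mul_apply]
    exact measurable_const.sub (Finset.measurable_sum _ fun c _ => (hK i c b).const_mul _)
  have h2 : Measurable fun q : Fin N × α => S.closedLoop (K q.2) q.1 a b :=
    measurable_from_prod_countable_right h1
  exact h2.comp (hw.prodMk measurable_id)

lemma measurable_state {α : Type*} [MeasurableSpace α] {K : α → Policy d k N}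
    {z : α → EuclideanSpace ℝ (Fin d) × (ℕ → Fin N)} (hK : ∀ i a b, Measurable fun s => K s i a b)
    (hz : Measurable z) (t : ℕ) (a : Fin d) : Measurable fun s => S.state (K s) (z s) t a := by
  induction t generalizing a with
  | zero =>
    change Measurable fun s => (z s).1 a
    fun_prop
  | succ t ih =>
    simp_rw [state_succ, mulVec, dotProduct]
    exact Finset.measurable_sum _ fun b _ =>
      (S.measurable_closedLoop_apply hK (by fun_prop) a b).mul (ih b)

lemma measurable_toMat_apply (a : Fin k) (b : Fin d) :
    Measurable fun u : EuclideanSpace ℝ (Fin k × Fin d) => toMat u a b := by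
  change Measurable fun u : EuclideanSpace ℝ (Fin k × Fin d) => u (a, b)
  fun_prop

end MJLS

/-! ### Cost-to-go matrices and what a finite cost implies -/

namespace MJLS

variable {d k N : ℕ} (S : MJLS d k N)

/-- Matrices of the quadratic forms `x ↦ E ∑_{t < n} x_tᵀ Q_{ω(t)} x_t`, started in `x` and in a
given mode. -/
noncomputable def costToGo (K : Policy d k N) : ℕ → Fin N → Matrix (Fin d) (Fin d) ℝ
  | 0 => fun _ => 0
  | n + 1 => fun i => S.Q i + (S.closedLoop K i)ᵀ *
      (∑ j, (S.trans i j).toReal • costToGo K n j) * S.closedLoop K i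

lemma posSemidef_costToGo (K : Policy d k N) (n : ℕ) (i : Fin N) :
    (S.costToGo K n i).PosSemidef := by
  induction n generalizing i with
  | zero => exact PosSemidef.zero
  | succ n ih =>
    refine (S.Q_posDef i).posSemidef.add ?_
    rw [← conjTranspose_eq_transpose_of_trivial]
    exact (posSemidef_sum _ fun j _ => (ih j).smul ENNReal.toReal_nonneg).conjTranspose_mul_mul_same _

lemma costToGo_one (K : Policy d k N) (i : Fin N) : S.costToGo K 1 i = S.Q i := by
  simp [costToGo]

lemma dotProduct_costToGo_succ (K : Policy d k N) (n : ℕ) (i : Fin N) (x : Fin d → ℝ) :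
    x ⬝ᵥ S.costToGo K (n + 1) i *ᵥ x = x ⬝ᵥ S.Q i *ᵥ x + (S.closedLoop K i *ᵥ x) ⬝ᵥ
      (∑ j, (S.trans i j).toReal • S.costToGo K n j) *ᵥ (S.closedLoop K i *ᵥ x) := by
  rw [costToGo, add_mulVec, dotProduct_add, dotProduct_transpose_mul_mul_mulVec]

lemma sum_trans_toReal (i : Fin N) : ∑ j, (S.trans i j).toReal = 1 := by
  rw [← ENNReal.toReal_sum fun j _ => (S.trans i).apply_ne_top j, ← tsum_fintype (L := .unconditional _),
    PMF.tsum_coe, ENNReal.toReal_one]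

lemma sum_init_toReal : ∑ i, (S.init i).toReal = 1 := by
  rw [← ENNReal.toReal_sum fun j _ => S.init.apply_ne_top j, ← tsum_fintype (L := .unconditional _),
    PMF.tsum_coe, ENNReal.toReal_one]

lemma measurable_quadratic_state {α : Type*} [MeasurableSpace α] {K : α → Policy d k N}
    {z : α → EuclideanSpace ℝ (Fin d) × (ℕ → Fin N)} (hK : ∀ i a b, Measurable fun s => K s i a b)
    (hz : Measurable z) (P : Fin N → Matrix (Fin d) (Fin d) ℝ) (t : ℕ) :
    Measurable fun s => S.state (K s) (z s) t ⬝ᵥ P ((z s).2 t) *ᵥ S.state (K s) (z s) t := by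
  simp only [mulVec, dotProduct]
  have hP : ∀ a b, Measurable fun s => P ((z s).2 t) a b := fun a b =>
    (measurable_of_countable fun i => P i a b).comp (by fun_prop)
  exact Finset.measurable_sum _ fun a _ => (S.measurable_state hK hz t a).mul
    (Finset.measurable_sum _ fun b _ => (hP a b).mul (S.measurable_state hK hz t b))

/-- One step of the state process, in expectation of a nonnegative quadratic form. -/
lemma lintegral_quadratic_state_succ (K : Policy d k N) (x : EuclideanSpace ℝ (Fin d)) (t : ℕ)
    {P : Fin N → Matrix (Fin d) (Fin d) ℝ} (hP : ∀ i, (P i).PosSemidef) :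
    ∫⁻ w, ENNReal.ofReal (S.state K (x, w) (t + 1) ⬝ᵥ
        P (w (t + 1)) *ᵥ S.state K (x, w) (t + 1)) ∂S.modeLaw =
      ∫⁻ w, ENNReal.ofReal ((S.closedLoop K (w t) *ᵥ S.state K (x, w) t) ⬝ᵥ
        (∑ j, (S.trans (w t) j).toReal • P j) *ᵥ
          (S.closedLoop K (w t) *ᵥ S.state K (x, w) t)) ∂S.modeLaw := by
  rw [S.lintegral_modeLaw_succ t (fun j w => ENNReal.ofReal (S.state K (x, w) (t + 1) ⬝ᵥ
        P j *ᵥ S.state K (x, w) (t + 1)))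
    fun j w w' h => by rw [S.state_congr K x fun s hs => h s (Nat.lt_succ_iff.1 hs)]]
  refine lintegral_congr fun w => ?_
  rw [sum_mulVec', dotProduct_sum, ENNReal.ofReal_sum_of_nonneg]
  · refine Finset.sum_congr rfl fun j _ => ?_
    rw [smul_mulVec, dotProduct_smul, smul_eq_mul, ENNReal.ofReal_mul ENNReal.toReal_nonneg,
      ENNReal.ofReal_toReal ((S.trans (w t)).apply_ne_top j), state_succ]
  · intro j _
    rw [smul_mulVec, dotProduct_smul]
    exact smul_nonneg ENNReal.toReal_nonneg ((hP j).dotProduct_mulVec_nonneg' _)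

/-- Peel off the first stage. The remaining ones start at `s + 1`, hence the induction is uniform in
`s`, and the Markov property brings their form back to time `s`. -/
lemma lintegral_sum_stage (K : Policy d k N) (x : EuclideanSpace ℝ (Fin d)) (n s : ℕ) :
    ∫⁻ w, ∑ t ∈ Finset.range n, ENNReal.ofReal (S.state K (x, w) (s + t) ⬝ᵥ
        S.Q (w (s + t)) *ᵥ S.state K (x, w) (s + t)) ∂S.modeLaw =
      ∫⁻ w, ENNReal.ofReal (S.state K (x, w) s ⬝ᵥ
        S.costToGo K n (w s) *ᵥ S.state K (x, w) s) ∂S.modeLaw := by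
  have hm : ∀ (P : Fin N → Matrix (Fin d) (Fin d) ℝ) t, Measurable fun w : ℕ → Fin N =>
      ENNReal.ofReal (S.state K (x, w) t ⬝ᵥ P (w t) *ᵥ S.state K (x, w) t) := fun P t =>
    (S.measurable_quadratic_state (K := fun _ => K) (z := fun w => (x, w))
      (fun _ _ _ => measurable_const) (by fun_prop) P t).ennreal_ofReal
  induction n generalizing s with
  | zero => simp [costToGo]
  | succ n ih =>
    simp_rw [Finset.sum_range_succ']
    rw [lintegral_add_right _ (by simpa using hm S.Q s)]
    have h1 := ih (s + 1)
    simp only [Nat.add_right_comm s 1] at h1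
    simp only [← Nat.add_assoc]
    rw [h1, S.lintegral_quadratic_state_succ K x s (S.posSemidef_costToGo K n), add_comm,
      ← lintegral_add_left (by simpa using hm S.Q s)]
    refine lintegral_congr fun w => ?_
    rw [dotProduct_costToGo_succ, ENNReal.ofReal_add
      ((S.Q_posDef _).posSemidef.dotProduct_mulVec_nonneg' _)]
    · rfl
    · exact (posSemidef_sum _ fun j _ => (S.posSemidef_costToGo K n j).smul
        ENNReal.toReal_nonneg).dotProduct_mulVec_nonneg' _

/-- Truncating in time and dropping the control cost only lowers the total. -/
lemma lintegral_costToGo_le_cost (K : Policy d k N) (n : ℕ) :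
    ∫⁻ x, ∑ i, S.init i * ENNReal.ofReal (x.ofLp ⬝ᵥ S.costToGo K n i *ᵥ x.ofLp) ∂S.D ≤
      S.cost K := by
  have hm : ∀ t, Measurable fun z : EuclideanSpace ℝ (Fin d) × (ℕ → Fin N) =>
      ENNReal.ofReal (S.state K z t ⬝ᵥ S.Q (z.2 t) *ᵥ S.state K z t) := fun t =>
    (S.measurable_quadratic_state (K := fun _ => K) (z := fun z => z)
      (fun _ _ _ => measurable_const) measurable_id S.Q t).ennreal_ofReal
  calc _ = ∫⁻ x, ∫⁻ w, ∑ t ∈ Finset.range n, ENNReal.ofReal (S.state K (x, w) t ⬝ᵥ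
        S.Q (w t) *ᵥ S.state K (x, w) t) ∂S.modeLaw ∂S.D := by
        refine lintegral_congr fun x => ?_
        have h := S.lintegral_sum_stage K x n 0
        simp only [zero_add] at h
        rw [h, ← S.lintegral_modeLaw_zero]
        rfl
    _ = ∫⁻ z, ∑ t ∈ Finset.range n, ENNReal.ofReal (S.state K z t ⬝ᵥ
        S.Q (z.2 t) *ᵥ S.state K z t) ∂S.baseLaw := by
        rw [baseLaw, lintegral_prod _ (Finset.measurable_sum _ fun t _ => hm t).aemeasurable]
    _ ≤ S.cost K := by
        refine lintegral_mono fun z => ?_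
        refine le_trans (Finset.sum_le_sum fun t _ => ENNReal.ofReal_le_ofReal ?_)
          (ENNReal.sum_le_tsum _)
        exact le_add_of_nonneg_right ((S.R_posDef _).posSemidef.dotProduct_mulVec_nonneg' _)

/-- Second moment matrix of the initial state. -/
noncomputable def secondMoment : Matrix (Fin d) (Fin d) ℝ := ∫ x, outer x.ofLp ∂S.D

lemma integrable_mul_coord {L : ℝ} (hL : ∀ᵐ x ∂S.D, ‖x‖ ≤ L) (a b : Fin d) :
    Integrable (fun x => x.ofLp a * x.ofLp b) S.D := by
  refine Integrable.of_bound (C := L * L) ?_ ?_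
  · exact Measurable.aestronglyMeasurable (by fun_prop)
  · filter_upwards [hL] with x hx
    rw [norm_mul]
    exact mul_le_mul ((PiLp.norm_apply_le x a).trans hx) ((PiLp.norm_apply_le x b).trans hx)
      (norm_nonneg _) ((norm_nonneg _).trans hx)

lemma secondMoment_apply {L : ℝ} (hL : ∀ᵐ x ∂S.D, ‖x‖ ≤ L) (a b : Fin d) :
    S.secondMoment a b = ∫ x, x.ofLp a * x.ofLp b ∂S.D := by
  exact Matrix.integral_apply (f := fun x : EuclideanSpace ℝ (Fin d) => outer x.ofLp)
    (fun a b => S.integrable_mul_coord hL a b) a b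

lemma quadratic_eq_sum (P : Matrix (Fin d) (Fin d) ℝ) (x : Fin d → ℝ) :
    x ⬝ᵥ P *ᵥ x = ∑ a, ∑ b, P a b * (x b * x a) := by
  simp only [dotProduct, mulVec, Finset.mul_sum]
  exact Finset.sum_congr rfl fun a _ => Finset.sum_congr rfl fun b _ => by ring

lemma integrable_quadratic {L : ℝ} (hL : ∀ᵐ x ∂S.D, ‖x‖ ≤ L) (P : Matrix (Fin d) (Fin d) ℝ) :
    Integrable (fun x => x.ofLp ⬝ᵥ P *ᵥ x.ofLp) S.D := by
  simp_rw [quadratic_eq_sum]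
  exact integrable_finsetSum _ fun a _ => integrable_finsetSum _ fun b _ =>
    (S.integrable_mul_coord hL b a).const_mul _

lemma integral_quadratic {L : ℝ} (hL : ∀ᵐ x ∂S.D, ‖x‖ ≤ L) (P : Matrix (Fin d) (Fin d) ℝ) :
    ∫ x, x.ofLp ⬝ᵥ P *ᵥ x.ofLp ∂S.D = (P * S.secondMoment).trace := by
  simp_rw [quadratic_eq_sum]
  have hi := fun a b => (S.integrable_mul_coord hL b a).const_mul (P a b)
  rw [integral_finsetSum _ fun a _ => integrable_finsetSum _ fun b _ => hi a b]
  simp_rw [integral_finsetSum _ fun b _ => hi _ b, integral_const_mul, trace, diag_apply, mul_apply,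
    S.secondMoment_apply hL]

lemma posSemidef_secondMoment {L : ℝ} (hL : ∀ᵐ x ∂S.D, ‖x‖ ≤ L) : S.secondMoment.PosSemidef := by
  refine posSemidef_of_isHermitian_of_nonneg ?_ fun y => ?_
  · ext a b
    rw [conjTranspose_apply, S.secondMoment_apply hL, S.secondMoment_apply hL, star_trivial]
    simp_rw [mul_comm]
  · rw [← trace_mul_vecMulVec_self, trace_mul_comm, ← S.integral_quadratic hL]
    refine integral_nonneg fun x => ?_
    simp only [vecMulVec_mulVec, dotProduct_smul, op_smul_eq_smul, smul_eq_mul, Pi.zero_apply]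
    rw [dotProduct_comm]
    exact mul_self_nonneg _

section Bounds

variable {M L : ℝ} {K : Policy d k N}

lemma sum_trace_costToGo_le (hL : ∀ᵐ x ∂S.D, ‖x‖ ≤ L) (hM : 0 < M)
    (hC : S.cost K ≤ ENNReal.ofReal M) (n : ℕ) :
    ∑ i, (S.init i).toReal * (S.costToGo K n i * S.secondMoment).trace ≤ M := by
  have h := (S.lintegral_costToGo_le_cost K n).trans hC
  have hnn : ∀ i (x : EuclideanSpace ℝ (Fin d)), 0 ≤ x.ofLp ⬝ᵥ S.costToGo K n i *ᵥ x.ofLp :=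
    fun i x => (S.posSemidef_costToGo K n i).dotProduct_mulVec_nonneg' _
  have heq : ∀ x : EuclideanSpace ℝ (Fin d),
      ∑ i, S.init i * ENNReal.ofReal (x.ofLp ⬝ᵥ S.costToGo K n i *ᵥ x.ofLp) =
      ENNReal.ofReal (∑ i, (S.init i).toReal * (x.ofLp ⬝ᵥ S.costToGo K n i *ᵥ x.ofLp)) := by
    intro x
    rw [ENNReal.ofReal_sum_of_nonneg fun i _ => mul_nonneg ENNReal.toReal_nonneg (hnn i x)]
    refine Finset.sum_congr rfl fun i _ => ?_
    rw [ENNReal.ofReal_mul ENNReal.toReal_nonneg, ENNReal.ofReal_toReal (S.init.apply_ne_top i)]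
  have hint : ∀ i, Integrable (fun x : EuclideanSpace ℝ (Fin d) =>
      (S.init i).toReal * (x.ofLp ⬝ᵥ S.costToGo K n i *ᵥ x.ofLp)) S.D :=
    fun i => (S.integrable_quadratic hL _).const_mul _
  simp_rw [heq] at h
  rw [← ofReal_integral_eq_lintegral_ofReal (integrable_finsetSum _ fun i _ => hint i)
    (ae_of_all _ fun x => Finset.sum_nonneg fun i _ => mul_nonneg ENNReal.toReal_nonneg (hnn i x)),
    ENNReal.ofReal_le_ofReal_iff hM.le, integral_finsetSum _ fun i _ => hint i] at h
  simpa only [integral_const_mul, S.integral_quadratic hL] using h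

lemma posSemidef_Q_sub (hQ : 1 / M ≤ lambdaMin S.Q) (i : Fin N) :
    (S.Q i - (1 / M) • (1 : Matrix (Fin d) (Fin d) ℝ)).PosSemidef :=
  (S.Q_posDef i).posSemidef.sub_smul_one (hQ.trans (lambdaMin_le _ i))

lemma posSemidef_secondMoment_sub (hL : ∀ᵐ x ∂S.D, ‖x‖ ≤ L) (hμ : 1 / M ≤ S.mu) (i : Fin N) :
    ((S.init i).toReal • S.secondMoment -
      (1 / M) • (1 : Matrix (Fin d) (Fin d) ℝ)).PosSemidef :=
  ((S.posSemidef_secondMoment hL).smul ENNReal.toReal_nonneg).sub_smul_one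
    (hμ.trans (lambdaMin_le _ i))

/-- Since π_i Σ ≥ I/M, tr(P)/M is at most π_i tr(PΣ), which is one term of a nonnegative sum bounded
by M. The bound does not depend on the horizon. -/
lemma trace_costToGo_le (hL : ∀ᵐ x ∂S.D, ‖x‖ ≤ L) (hM : 0 < M)
    (hC : S.cost K ≤ ENNReal.ofReal M) (hμ : 1 / M ≤ S.mu) (n : ℕ) (i : Fin N) :
    (S.costToGo K n i).trace ≤ M ^ 2 := by
  have h1 := (S.posSemidef_costToGo K n i).trace_mul_nonneg (S.posSemidef_secondMoment_sub hL hμ i)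
  rw [Matrix.mul_sub, trace_sub, Matrix.mul_smul, Matrix.mul_smul, Matrix.mul_one, trace_smul,
    trace_smul, smul_eq_mul, smul_eq_mul] at h1
  have h2 := Finset.single_le_sum (f := fun i => (S.init i).toReal *
    (S.costToGo K n i * S.secondMoment).trace) (fun i _ => mul_nonneg ENNReal.toReal_nonneg
      ((S.posSemidef_costToGo K n i).trace_mul_nonneg (S.posSemidef_secondMoment hL)))
      (Finset.mem_univ i)
  have h3 := S.sum_trace_costToGo_le hL hM hC n
  have h4 : 1 / M * (S.costToGo K n i).trace ≤ M := by linarith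
  rw [one_div, inv_mul_le_iff₀ hM] at h4
  linarith

/-- Horizon one already suffices: Q_i ≥ I/M and ∑ π_i = 1. -/
lemma trace_secondMoment_le (hL : ∀ᵐ x ∂S.D, ‖x‖ ≤ L) (hM : 0 < M)
    (hC : S.cost K ≤ ENNReal.ofReal M) (hQ : 1 / M ≤ lambdaMin S.Q) :
    S.secondMoment.trace ≤ M ^ 2 := by
  have h3 := S.sum_trace_costToGo_le hL hM hC 1
  have h4 : ∑ i, (S.init i).toReal * (1 / M * S.secondMoment.trace) ≤ M := by
    refine le_trans (Finset.sum_le_sum fun i _ => ?_) h3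
    refine mul_le_mul_of_nonneg_left ?_ ENNReal.toReal_nonneg
    have h := (S.posSemidef_Q_sub hQ i).trace_mul_nonneg (S.posSemidef_secondMoment hL)
    rw [Matrix.sub_mul, trace_sub, Matrix.smul_mul, Matrix.one_mul, trace_smul, smul_eq_mul] at h
    rw [costToGo_one]
    linarith
  rw [← Finset.sum_mul, S.sum_init_toReal, one_mul, one_div, inv_mul_le_iff₀ hM] at h4
  linarith

/-- Taking traces in π_i Σ ≥ I/M and summing over i yields N d / M ≤ tr Σ ≤ M². -/
lemma card_mul_dim_le (hL : ∀ᵐ x ∂S.D, ‖x‖ ≤ L) (hM : 0 < M)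
    (hC : S.cost K ≤ ENNReal.ofReal M) (hQ : 1 / M ≤ lambdaMin S.Q) (hμ : 1 / M ≤ S.mu) :
    (N : ℝ) * d ≤ M ^ 3 := by
  have h1 : ∑ _i : Fin N, 1 / M * (d : ℝ) ≤ ∑ i, (S.init i).toReal * S.secondMoment.trace := by
    refine Finset.sum_le_sum fun i _ => ?_
    have h := (S.posSemidef_secondMoment_sub hL hμ i).trace_nonneg
    rw [trace_sub, trace_smul, trace_smul, trace_one, Fintype.card_fin, smul_eq_mul,
      smul_eq_mul] at h
    linarith
  rw [← Finset.sum_mul _ (fun i => (S.init i).toReal), S.sum_init_toReal, one_mul,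
    Finset.sum_const, Finset.card_univ,
    Fintype.card_fin, nsmul_eq_mul] at h1
  have h2 := h1.trans (S.trace_secondMoment_le hL hM hC hQ)
  have h3 : (N : ℝ) * (1 / M * d) = 1 / M * (N * d) := by ring
  rw [h3, one_div, inv_mul_le_iff₀ hM] at h2
  linarith

end Bounds

lemma mode_pos (S : MJLS d k N) : 0 < N := by
  obtain ⟨i, -⟩ := (PMF.support_nonempty S.init)
  exact i.pos

/-- The trace of π_i Σ ≥ μ I gives d μ ≤ tr Σ. The bound later trades L² for L²/μ. -/
lemma mu_le {M L : ℝ} {K : Policy d k N} (hd : 0 < d) (hL : ∀ᵐ x ∂S.D, ‖x‖ ≤ L) (hM : 0 < M)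
    (hC : S.cost K ≤ ENNReal.ofReal M) (hQ : 1 / M ≤ lambdaMin S.Q) : S.mu ≤ M ^ 2 := by
  by_contra! hlt
  -- With 1/μ in the role of M the lower bound on μ is a tautology.
  have h1 : 1 / (1 / S.mu) ≤ S.mu := by rw [one_div_one_div]
  have i : Fin N := ⟨0, S.mode_pos⟩
  have h := (S.posSemidef_secondMoment_sub (M := 1 / S.mu) hL h1 i).trace_nonneg
  rw [trace_sub, trace_smul, trace_smul, trace_one, Fintype.card_fin, smul_eq_mul,
      smul_eq_mul, one_div_one_div] at h
  have h2 := S.trace_secondMoment_le hL hM hC hQ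
  have h3 : (S.init i).toReal ≤ 1 := ENNReal.toReal_le_of_le_ofReal zero_le_one
    (by simpa using S.init.coe_le_one i)
  have h4 := (S.posSemidef_secondMoment hL).trace_nonneg
  have h5 : (1 : ℝ) ≤ d := by exact_mod_cast hd
  nlinarith [mul_le_mul_of_nonneg_right h3 h4, sq_nonneg M]

end MJLS

/-! ### Lyapunov contraction and pathwise bounds -/

namespace MJLS

variable {d k N : ℕ} (S : MJLS d k N)

/-- The standing bounds on a system and a policy. -/
structure Bounded (K : Policy d k N) (M : ℝ) : Prop where
  one_le : 1 ≤ M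
  norm_B_le : ∀ i, ‖S.B i‖ ≤ M
  norm_closedLoop_le : ∀ i, ‖S.closedLoop K i‖ ≤ M
  cost_le : S.cost K ≤ ENNReal.ofReal M
  le_Q : 1 / M ≤ lambdaMin S.Q
  le_mu : 1 / M ≤ S.mu
  ae_le : ∃ L : ℝ, ∀ᵐ x ∂S.D, ‖x‖ ≤ L

/-- Contraction rate of the mean square dynamics. -/
noncomputable def _root_.mjlsRate (M : ℝ) : ℝ := 1 - 1 / (4 * M ^ 3)

lemma _root_.mjlsRate_pos {M : ℝ} (hM : 1 ≤ M) : 0 < mjlsRate M := by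
  have h : 1 / (4 * M ^ 3) ≤ 1 / 4 :=
    one_div_le_one_div_of_le (by norm_num) (by linarith [one_le_pow₀ hM (n := 3)])
  unfold mjlsRate
  linarith

lemma _root_.mjlsRate_lt_one {M : ℝ} (hM : 1 ≤ M) : mjlsRate M < 1 := by
  have : 0 < 1 / (4 * M ^ 3) := by positivity
  unfold mjlsRate
  linarith

variable {S} {K : Policy d k N} {M : ℝ}

namespace Bounded

lemma pos (h : S.Bounded K M) : 0 < M := one_pos.trans_le h.one_le

lemma quadratic_costToGo_le (h : S.Bounded K M) (n : ℕ) (i : Fin N) (x : Fin d → ℝ) :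
    x ⬝ᵥ S.costToGo K n i *ᵥ x ≤ M ^ 2 * (x ⬝ᵥ x) := by
  obtain ⟨L, hL⟩ := h.ae_le
  exact ((S.posSemidef_costToGo K n i).dotProduct_mulVec_le_trace x).trans
    (mul_le_mul_of_nonneg_right (S.trace_costToGo_le hL h.pos h.cost_le h.le_mu n i)
      (dotProduct_self_nonneg' x))

lemma le_quadratic_Q (h : S.Bounded K M) (i : Fin N) (x : Fin d → ℝ) :
    1 / M * (x ⬝ᵥ x) ≤ x ⬝ᵥ S.Q i *ᵥ x := by
  have := (S.posSemidef_Q_sub h.le_Q i).dotProduct_mulVec_nonneg' x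
  rw [sub_mulVec, dotProduct_sub, smul_mulVec, one_mulVec, dotProduct_smul, smul_eq_mul] at this
  linarith

lemma le_quadratic_costToGo_succ (h : S.Bounded K M) (n : ℕ) (i : Fin N) (x : Fin d → ℝ) :
    1 / M * (x ⬝ᵥ x) ≤ x ⬝ᵥ S.costToGo K (n + 1) i *ᵥ x := by
  rw [dotProduct_costToGo_succ]
  exact (h.le_quadratic_Q i x).trans (le_add_of_nonneg_right ((posSemidef_sum _ fun j _ =>
    (S.posSemidef_costToGo K n j).smul ENNReal.toReal_nonneg).dotProduct_mulVec_nonneg' _))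

/-- The cost-to-go is a Lyapunov function for all policies close to `K`. -/
lemma contraction (h : S.Bounded K M) {U : Matrix (Fin k) (Fin d) ℝ} {r : ℝ}
    (hr0 : 0 ≤ r) (hr : r ≤ 1 / (4 * M ^ 6))
    (hU : ∀ x : Fin d → ℝ, ‖WithLp.toLp 2 (U *ᵥ x)‖ ≤ r * ‖WithLp.toLp 2 x‖)
    (n : ℕ) (i : Fin N) (x : Fin d → ℝ) :
    (S.closedLoop (fun p => K p + U) i *ᵥ x) ⬝ᵥ
      (∑ j, (S.trans i j).toReal • S.costToGo K n j) *ᵥ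
        (S.closedLoop (fun p => K p + U) i *ᵥ x) ≤
      mjlsRate M * (x ⬝ᵥ S.costToGo K (n + 1) i *ᵥ x) := by
  have hM := h.pos
  have hM1 := h.one_le
  rw [closedLoop_add_mulVec]
  set W := ∑ j, (S.trans i j).toReal • S.costToGo K n j with hW
  set a := S.closedLoop K i *ᵥ x
  set b := -(S.B i *ᵥ (U *ᵥ x)) with hb
  set v := x ⬝ᵥ S.costToGo K (n + 1) i *ᵥ x with hv
  have hWpsd : W.PosSemidef := posSemidef_sum _ fun j _ =>
    (S.posSemidef_costToGo K n j).smul ENNReal.toReal_nonneg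
  -- This `s` spends half of the decrease 1/M³ on the cross terms: (1 + s)(1 - 1/M³) ≤ 1 - 1/(2M³).
  have hadd := dotProduct_mulVec_add_le (hWpsd.dotProduct_mulVec_nonneg') a b
    (s := 1 / (2 * M ^ 3)) (by positivity)
  have hxx := dotProduct_self_nonneg' x
  have hxv : x ⬝ᵥ x ≤ M * v := by
    have := h.le_quadratic_costToGo_succ n i x
    rwa [one_div, inv_mul_le_iff₀ hM] at this
  have hv0 : 0 ≤ v := (S.posSemidef_costToGo K (n + 1) i).dotProduct_mulVec_nonneg' x
  have ha : a ⬝ᵥ W *ᵥ a ≤ (1 - 1 / M ^ 3) * v := by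
    have h1 : v = x ⬝ᵥ S.Q i *ᵥ x + a ⬝ᵥ W *ᵥ a := S.dotProduct_costToGo_succ K n i x
    have h2 := h.le_quadratic_Q i x
    have h3 : v / M ^ 3 ≤ 1 / M * (x ⬝ᵥ x) := by
      rw [div_le_iff₀ (by positivity)]
      calc v ≤ M ^ 2 * (x ⬝ᵥ x) := h.quadratic_costToGo_le _ _ _
        _ = 1 / M * (x ⬝ᵥ x) * M ^ 3 := by field_simp
    have h4 : (1 - 1 / M ^ 3) * v = v - v / M ^ 3 := by ring
    linarith
  have hbb : b ⬝ᵥ W *ᵥ b ≤ v * M ^ 5 * r ^ 2 := by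
    have h1 : b ⬝ᵥ W *ᵥ b ≤ M ^ 2 * (b ⬝ᵥ b) := by
      rw [hW, sum_mulVec', dotProduct_sum]
      calc _ ≤ ∑ j, (S.trans i j).toReal * (M ^ 2 * (b ⬝ᵥ b)) := by
            refine Finset.sum_le_sum fun j _ => ?_
            rw [smul_mulVec, dotProduct_smul, smul_eq_mul]
            exact mul_le_mul_of_nonneg_left (h.quadratic_costToGo_le _ _ _) ENNReal.toReal_nonneg
        _ = _ := by rw [← Finset.sum_mul, S.sum_trans_toReal, one_mul]
    have h2 : b ⬝ᵥ b ≤ M ^ 2 * r ^ 2 * (x ⬝ᵥ x) := by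
      rw [hb, neg_dotProduct_neg, ← norm_toLp_sq, ← norm_toLp_sq]
      have h3 := norm_toLp_mulVec_le (S.B i) (U *ᵥ x)
      calc _ ≤ (M * (r * ‖WithLp.toLp 2 x‖)) ^ 2 := by
            gcongr
            exact h3.trans (mul_le_mul (h.norm_B_le i) (hU x) (norm_nonneg _) hM.le)
        _ = _ := by ring
    calc b ⬝ᵥ W *ᵥ b ≤ M ^ 2 * (M ^ 2 * r ^ 2 * (M * v)) := by
          refine h1.trans (mul_le_mul_of_nonneg_left (h2.trans ?_) (by positivity))
          exact mul_le_mul_of_nonneg_left hxv (by positivity)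
      _ = _ := by ring
  have hr2 : M ^ 5 * r ^ 2 ≤ 1 / (16 * M ^ 7) := by
    calc M ^ 5 * r ^ 2 ≤ M ^ 5 * (1 / (4 * M ^ 6)) ^ 2 := by gcongr
      _ = _ := by field_simp; norm_num
  -- The perturbation costs at most 3/16 of 1/M³, and 1/2 - 3/16 ≥ 1/4 leaves the rate `mjlsRate M`.
  have hb3 : (1 + 1 / (1 / (2 * M ^ 3))) * (b ⬝ᵥ W *ᵥ b) ≤ 3 / (16 * M ^ 3) * v := by
    rw [one_div_one_div]
    have h1 : 1 + 2 * M ^ 3 ≤ 3 * M ^ 3 := by linarith [one_le_pow₀ hM1 (n := 3)]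
    calc _ ≤ 3 * M ^ 3 * (v * (1 / (16 * M ^ 7))) := by
          refine mul_le_mul h1 (hbb.trans ?_) (hWpsd.dotProduct_mulVec_nonneg' b) (by positivity)
          rw [mul_assoc]
          exact mul_le_mul_of_nonneg_left hr2 hv0
      _ = 3 / (16 * M ^ 4) * v := by field_simp
      _ ≤ _ := by
          gcongr
          norm_num
  have ha3 : (1 + 1 / (2 * M ^ 3)) * (a ⬝ᵥ W *ᵥ a) ≤ (1 - 1 / (2 * M ^ 3)) * v := by
    calc _ ≤ (1 + 1 / (2 * M ^ 3)) * ((1 - 1 / M ^ 3) * v) :=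
          mul_le_mul_of_nonneg_left ha (by positivity)
      _ = ((1 + 1 / (2 * M ^ 3)) * (1 - 1 / M ^ 3)) * v := by ring
      _ ≤ _ := by
          refine mul_le_mul_of_nonneg_right ?_ hv0
          have h1 : (1 + 1 / (2 * M ^ 3)) * (1 - 1 / M ^ 3) =
            1 - 1 / (2 * M ^ 3) - 1 / (2 * M ^ 3) * (1 / M ^ 3) := by field_simp; ring
          rw [h1]
          have : 0 ≤ 1 / (2 * M ^ 3) * (1 / M ^ 3) := by positivity
          linarith
  refine hadd.trans ((add_le_add ha3 hb3).trans ?_)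
  rw [← add_mul]
  refine mul_le_mul_of_nonneg_right ?_ hv0
  have h1 : mjlsRate M - (1 - 1 / (2 * M ^ 3) + 3 / (16 * M ^ 3)) = 1 / (16 * M ^ 3) := by
    unfold mjlsRate; field_simp; ring
  have h2 : 0 ≤ 1 / (16 * M ^ 3) := by positivity
  linarith

/-- Mean square decay of the state, uniformly over the policies close to `K`. -/
lemma lintegral_state_sq_le (h : S.Bounded K M) {U : Matrix (Fin k) (Fin d) ℝ} {r : ℝ}
    (hr0 : 0 ≤ r) (hr : r ≤ 1 / (4 * M ^ 6))
    (hU : ∀ x : Fin d → ℝ, ‖WithLp.toLp 2 (U *ᵥ x)‖ ≤ r * ‖WithLp.toLp 2 x‖)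
    (x : EuclideanSpace ℝ (Fin d)) (t : ℕ) :
    ∫⁻ w, ENNReal.ofReal (S.state (fun p => K p + U) (x, w) t ⬝ᵥ
      S.state (fun p => K p + U) (x, w) t) ∂S.modeLaw ≤
        ENNReal.ofReal (M ^ 3 * mjlsRate M ^ t * (x.ofLp ⬝ᵥ x.ofLp)) := by
  have hρ := (mjlsRate_pos h.one_le).le
  -- Each step back in time lengthens the horizon by one, so `n` must vary in the induction. The
  -- bounds on the forms are uniform in the horizon.
  have key : ∀ n, ∫⁻ w, ENNReal.ofReal (S.state (fun p => K p + U) (x, w) t ⬝ᵥ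
      S.costToGo K (n + 1) (w t) *ᵥ S.state (fun p => K p + U) (x, w) t) ∂S.modeLaw ≤
        ENNReal.ofReal (mjlsRate M ^ t) * ∫⁻ w, ENNReal.ofReal (x.ofLp ⬝ᵥ
          S.costToGo K (n + 1 + t) (w 0) *ᵥ x.ofLp) ∂S.modeLaw := by
    induction t with
    | zero => intro n; simp [state]
    | succ t ih =>
      intro n
      rw [S.lintegral_quadratic_state_succ _ x t (S.posSemidef_costToGo K (n + 1))]
      calc _ ≤ ∫⁻ w, ENNReal.ofReal (mjlsRate M) * ENNReal.ofReal
              (S.state (fun p => K p + U) (x, w) t ⬝ᵥ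
              S.costToGo K (n + 1 + 1) (w t) *ᵥ S.state (fun p => K p + U) (x, w) t)
              ∂S.modeLaw := by
            refine lintegral_mono fun w => ?_
            rw [← ENNReal.ofReal_mul hρ]
            exact ENNReal.ofReal_le_ofReal (h.contraction hr0 hr hU (n + 1) (w t) _)
        _ ≤ _ := by
            rw [lintegral_const_mul' _ _ ENNReal.ofReal_ne_top, pow_succ', ENNReal.ofReal_mul hρ,
              mul_assoc]
            gcongr
            have h1 := ih (n + 1)
            rwa [show n + 1 + 1 + t = n + 1 + (t + 1) by ring] at h1
  calc _ ≤ ∫⁻ w, ENNReal.ofReal M * ENNReal.ofReal (S.state (fun p => K p + U) (x, w) t ⬝ᵥ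
      S.costToGo K (0 + 1) (w t) *ᵥ S.state (fun p => K p + U) (x, w) t) ∂S.modeLaw := by
        refine lintegral_mono fun w => ?_
        rw [← ENNReal.ofReal_mul h.pos.le]
        refine ENNReal.ofReal_le_ofReal ?_
        have := h.le_quadratic_costToGo_succ 0 (w t) (S.state (fun p => K p + U) (x, w) t)
        rwa [one_div, inv_mul_le_iff₀ h.pos] at this
    _ ≤ ENNReal.ofReal M * (ENNReal.ofReal (mjlsRate M ^ t) *
          ∫⁻ w, ENNReal.ofReal (M ^ 2 * (x.ofLp ⬝ᵥ x.ofLp)) ∂S.modeLaw) := by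
        rw [lintegral_const_mul' _ _ ENNReal.ofReal_ne_top]
        gcongr
        refine (key 0).trans ?_
        gcongr
        exact h.quadratic_costToGo_le _ _ _
    _ = _ := by
        rw [lintegral_const, measure_univ, mul_one, ← ENNReal.ofReal_mul (pow_nonneg hρ _),
          ← ENNReal.ofReal_mul h.pos.le]
        congr 1
        ring

lemma norm_closedLoop_mulVec_le (h : S.Bounded K M) {U : Matrix (Fin k) (Fin d) ℝ} {r : ℝ}
    (hr1 : r ≤ 1)
    (hU : ∀ x : Fin d → ℝ, ‖WithLp.toLp 2 (U *ᵥ x)‖ ≤ r * ‖WithLp.toLp 2 x‖)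
    (i : Fin N) (x : Fin d → ℝ) :
    ‖WithLp.toLp 2 (S.closedLoop (fun p => K p + U) i *ᵥ x)‖ ≤ 2 * M * ‖WithLp.toLp 2 x‖ := by
  rw [closedLoop_add_mulVec, WithLp.toLp_add, WithLp.toLp_neg]
  refine (norm_add_le _ _).trans ?_
  rw [norm_neg]
  have h1 := (norm_toLp_mulVec_le (S.closedLoop K i) x).trans
    (mul_le_mul_of_nonneg_right (h.norm_closedLoop_le i) (norm_nonneg _))
  have h2 := (norm_toLp_mulVec_le (S.B i) (U *ᵥ x)).trans
    (mul_le_mul (h.norm_B_le i) ((hU x).trans (mul_le_of_le_one_left (norm_nonneg _) hr1))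
      (norm_nonneg _) h.pos.le)
  linarith

/-- Deterministic growth bound. -/
lemma norm_state_le (h : S.Bounded K M) {U : Matrix (Fin k) (Fin d) ℝ} {r : ℝ}
    (hr1 : r ≤ 1)
    (hU : ∀ x : Fin d → ℝ, ‖WithLp.toLp 2 (U *ᵥ x)‖ ≤ r * ‖WithLp.toLp 2 x‖)
    (z : EuclideanSpace ℝ (Fin d) × (ℕ → Fin N)) (t : ℕ) :
    ‖WithLp.toLp 2 (S.state (fun p => K p + U) z t)‖ ≤ (2 * M) ^ t * ‖z.1‖ := by
  have hM := h.pos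
  induction t with
  | zero => simp [state]
  | succ t ih =>
    rw [state_succ, pow_succ', mul_assoc]
    exact (h.norm_closedLoop_mulVec_le hr1 hU _ _).trans
      (mul_le_mul_of_nonneg_left ih (by positivity))

/-- Deterministic perturbation bound. -/
lemma norm_state_sub_le (h : S.Bounded K M) {U : Matrix (Fin k) (Fin d) ℝ} {r : ℝ}
    (hr0 : 0 ≤ r) (hr1 : r ≤ 1)
    (hU : ∀ x : Fin d → ℝ, ‖WithLp.toLp 2 (U *ᵥ x)‖ ≤ r * ‖WithLp.toLp 2 x‖)
    (z : EuclideanSpace ℝ (Fin d) × (ℕ → Fin N)) (t : ℕ) :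
    ‖WithLp.toLp 2 (S.state (fun p => K p + U) z t - S.state K z t)‖ ≤
      r * (2 * M) ^ t * ‖z.1‖ := by
  have hM := h.pos
  induction t with
  | zero => simpa [state] using mul_nonneg hr0 (norm_nonneg _)
  | succ t ih =>
    have h0 : S.state (fun p => K p + U) z (t + 1) - S.state K z (t + 1) =
        S.closedLoop K (z.2 t) *ᵥ (S.state (fun p => K p + U) z t - S.state K z t) +
          -(S.B (z.2 t) *ᵥ (U *ᵥ S.state (fun p => K p + U) z t)) := by
      rw [state_succ, state_succ, closedLoop_add_mulVec, mulVec_sub]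
      abel
    rw [h0, WithLp.toLp_add, WithLp.toLp_neg]
    refine (norm_add_le _ _).trans ?_
    rw [norm_neg]
    have h1 := (norm_toLp_mulVec_le (S.closedLoop K (z.2 t))
      (S.state (fun p => K p + U) z t - S.state K z t)).trans
        (mul_le_mul (h.norm_closedLoop_le _) ih (norm_nonneg _) hM.le)
    have h2 := (norm_toLp_mulVec_le (S.B (z.2 t)) (U *ᵥ S.state (fun p => K p + U) z t)).trans
      (mul_le_mul (h.norm_B_le _) ((hU _).trans
        (mul_le_mul_of_nonneg_left (h.norm_state_le hr1 hU z t) hr0)) (norm_nonneg _) hM.le)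
    -- The propagated error and the new error have the same bound M r (2M)^t ‖x_0‖, so their sum
    -- supplies the next factor 2M.
    calc _ ≤ _ := add_le_add h1 h2
      _ = _ := by ring

end Bounded

end MJLS

/-! ### The law of the perturbation -/

lemma isProbabilityMeasure_sphereLaw {d k : ℕ} (hd : 0 < d) (hk : 0 < k) (r : ℝ) :
    IsProbabilityMeasure (sphereLaw d k r) := by
  have : Nonempty (Fin k × Fin d) := ⟨(⟨0, hk⟩, ⟨0, hd⟩)⟩
  have : Nontrivial (EuclideanSpace ℝ (Fin k × Fin d)) := inferInstance
  have h0 : (volume : Measure (EuclideanSpace ℝ (Fin k × Fin d))).toSphere Set.univ ≠ 0 := by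
    rw [Ne, Measure.measure_univ_eq_zero]
    exact Measure.toSphere_ne_zero _
  have : IsProbabilityMeasure (((volume : Measure (EuclideanSpace ℝ (Fin k × Fin d))).toSphere
      Set.univ)⁻¹ • (volume : Measure (EuclideanSpace ℝ (Fin k × Fin d))).toSphere) :=
    ⟨by rw [Measure.smul_apply, smul_eq_mul, ENNReal.inv_mul_cancel h0 (measure_ne_top _ _)]⟩
  exact Measure.isProbabilityMeasure_map (by fun_prop)

lemma ae_sphereLaw_norm_eq {d k : ℕ} {r : ℝ} (hr : 0 ≤ r) :
    ∀ᵐ u ∂sphereLaw d k r, ‖u‖ = r := by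
  unfold sphereLaw
  rw [ae_map_iff (by fun_prop) (measurableSet_eq_fun (by fun_prop) (by fun_prop))]
  refine ae_of_all _ fun u => ?_
  rw [norm_smul, norm_eq_of_mem_sphere, Real.norm_of_nonneg hr, mul_one]

/-! ### Moments of the entries and bias of the truncated estimator -/

namespace MJLS

variable {d k N : ℕ} {S : MJLS d k N} {K : Policy d k N} {M : ℝ}

/-- Entry `(a, b)` of `x_t x_tᵀ 1_{ω(t) = i}`. -/
def corrEntry (S : MJLS d k N) (K : Policy d k N) (t : ℕ) (i : Fin N) (a b : Fin d)
    (z : EuclideanSpace ℝ (Fin d) × (ℕ → Fin N)) : ℝ :=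
  if z.2 t = i then S.state K z t a * S.state K z t b else 0

lemma abs_corrEntry_le (K : Policy d k N) (t : ℕ) (i : Fin N) (a b : Fin d)
    (z : EuclideanSpace ℝ (Fin d) × (ℕ → Fin N)) :
    |S.corrEntry K t i a b z| ≤ S.state K z t ⬝ᵥ S.state K z t := by
  unfold corrEntry
  split_ifs
  · rw [abs_mul, ← norm_toLp_sq, sq]
    exact mul_le_mul (PiLp.norm_apply_le (WithLp.toLp 2 (S.state K z t)) a)
      (PiLp.norm_apply_le (WithLp.toLp 2 (S.state K z t)) b) (abs_nonneg _) (norm_nonneg _)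
  · simpa using dotProduct_self_nonneg' (S.state K z t)

lemma measurable_corrEntry {α : Type*} [MeasurableSpace α] {K : α → Policy d k N}
    {z : α → EuclideanSpace ℝ (Fin d) × (ℕ → Fin N)} (hK : ∀ i a b, Measurable fun s => K s i a b)
    (hz : Measurable z) (t : ℕ) (i : Fin N) (a b : Fin d) :
    Measurable fun s => S.corrEntry (K s) t i a b (z s) := by
  refine Measurable.ite ?_ ((S.measurable_state hK hz t a).mul (S.measurable_state hK hz t b))
    measurable_const
  exact (measurableSet_singleton i).preimage (f := fun s => (z s).2 t) (by fun_prop)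

lemma measurable_corrEntry_rollout (K : Policy d k N) (t : ℕ) (i : Fin N) (a b : Fin d) :
    Measurable fun s : EuclideanSpace ℝ (Fin k × Fin d) × EuclideanSpace ℝ (Fin d) × (ℕ → Fin N) =>
      S.corrEntry (fun p => K p + toMat s.1) t i a b s.2 :=
  measurable_corrEntry (fun i a b => by
    simp only [Matrix.add_apply]
    exact ((measurable_toMat_apply a b).comp measurable_fst).const_add _) measurable_snd t i a b

lemma measurable_state_sq_rollout (K : Policy d k N) (t : ℕ) :
    Measurable fun s : EuclideanSpace ℝ (Fin k × Fin d) × EuclideanSpace ℝ (Fin d) × (ℕ → Fin N) =>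
      S.state (fun p => K p + toMat s.1) s.2 t ⬝ᵥ S.state (fun p => K p + toMat s.1) s.2 t := by
  simpa using S.measurable_quadratic_state
    (K := fun s : EuclideanSpace ℝ (Fin k × Fin d) × EuclideanSpace ℝ (Fin d) × (ℕ → Fin N) =>
      fun p => K p + toMat s.1) (z := fun s => s.2) (fun i a b => by
    simp only [Matrix.add_apply]
    exact ((measurable_toMat_apply a b).comp measurable_fst).const_add _) measurable_snd
    (fun _ => 1) t

namespace Bounded

lemma lintegral_norm_sq_le (h : S.Bounded K M) :
    ∫⁻ x, ENNReal.ofReal (‖x‖ ^ 2) ∂S.D ≤ ENNReal.ofReal (M ^ 2) := by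
  obtain ⟨L, hL⟩ := h.ae_le
  have h1 : ∀ x : EuclideanSpace ℝ (Fin d), ‖x‖ ^ 2 = x.ofLp ⬝ᵥ (1 : Matrix (Fin d) (Fin d) ℝ) *ᵥ
      x.ofLp := fun x => by rw [one_mulVec, ← norm_toLp_sq]
  simp_rw [h1]
  rw [← ofReal_integral_eq_lintegral_ofReal (S.integrable_quadratic hL _)
    (ae_of_all _ fun x => (sq_nonneg ‖x‖).trans_eq (h1 x)), S.integral_quadratic hL,
    Matrix.one_mul]
  exact ENNReal.ofReal_le_ofReal (S.trace_secondMoment_le hL h.pos h.cost_le h.le_Q)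

lemma lintegral_baseLaw_state_sq_le (h : S.Bounded K M) {U : Matrix (Fin k) (Fin d) ℝ} {r : ℝ}
    (hr0 : 0 ≤ r) (hr : r ≤ 1 / (4 * M ^ 6))
    (hU : ∀ x : Fin d → ℝ, ‖WithLp.toLp 2 (U *ᵥ x)‖ ≤ r * ‖WithLp.toLp 2 x‖) (t : ℕ) :
    ∫⁻ z, ENNReal.ofReal (S.state (fun p => K p + U) z t ⬝ᵥ
      S.state (fun p => K p + U) z t) ∂S.baseLaw ≤ ENNReal.ofReal (M ^ 5 * mjlsRate M ^ t) := by
  have hρ := pow_nonneg (mjlsRate_pos h.one_le).le t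
  have hM := h.pos
  have hm : Measurable fun z : EuclideanSpace ℝ (Fin d) × (ℕ → Fin N) =>
      S.state (fun p => K p + U) z t ⬝ᵥ S.state (fun p => K p + U) z t := by
    simpa using S.measurable_quadratic_state
      (K := fun z : EuclideanSpace ℝ (Fin d) × (ℕ → Fin N) => fun p => K p + U)
      (fun _ _ _ => measurable_const) measurable_id (fun _ => 1) t
  rw [baseLaw, lintegral_prod _ hm.ennreal_ofReal.aemeasurable]
  calc _ ≤ ∫⁻ x, ENNReal.ofReal (M ^ 3 * mjlsRate M ^ t) * ENNReal.ofReal (‖x‖ ^ 2) ∂S.D := by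
        refine lintegral_mono fun x => (h.lintegral_state_sq_le hr0 hr hU x t).trans_eq ?_
        rw [← norm_toLp_sq, ENNReal.ofReal_mul (by positivity)]
    _ ≤ ENNReal.ofReal (M ^ 3 * mjlsRate M ^ t) * ENNReal.ofReal (M ^ 2) := by
        rw [lintegral_const_mul' _ _ ENNReal.ofReal_ne_top]
        gcongr
        exact h.lintegral_norm_sq_le
    _ = _ := by
        rw [← ENNReal.ofReal_mul (by positivity)]
        congr 1
        ring

lemma lintegral_rolloutLaw_state_sq_le (h : S.Bounded K M) (hd : 0 < d) (hk : 0 < k) {r : ℝ}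
    (hr0 : 0 ≤ r) (hr : r ≤ 1 / (4 * M ^ 6)) (t : ℕ) :
    ∫⁻ s, ENNReal.ofReal (S.state (fun p => K p + toMat s.1) s.2 t ⬝ᵥ
      S.state (fun p => K p + toMat s.1) s.2 t) ∂S.rolloutLaw r ≤
        ENNReal.ofReal (M ^ 5 * mjlsRate M ^ t) := by
  have := isProbabilityMeasure_sphereLaw hd hk r
  rw [rolloutLaw, lintegral_prod _ (measurable_state_sq_rollout K t).ennreal_ofReal.aemeasurable]
  refine (lintegral_mono_ae ?_).trans_eq
    ((lintegral_const _).trans (by rw [measure_univ, mul_one]))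
  filter_upwards [ae_sphereLaw_norm_eq hr0] with u hu
  exact h.lintegral_baseLaw_state_sq_le hr0 hr (fun x => hu ▸ norm_toMat_mulVec_le u x) t

lemma lintegral_state_sq_le_self (h : S.Bounded K M) (t : ℕ) :
    ∫⁻ z, ENNReal.ofReal (S.state K z t ⬝ᵥ S.state K z t) ∂S.baseLaw ≤
      ENNReal.ofReal (M ^ 5 * mjlsRate M ^ t) := by
  have hM := h.pos
  simpa using h.lintegral_baseLaw_state_sq_le (U := 0) le_rfl (by positivity) (by simp) t

lemma integrable_corrEntry (h : S.Bounded K M) (t : ℕ) (i : Fin N) (a b : Fin d) :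
    Integrable (S.corrEntry K t i a b) S.baseLaw := by
  refine ⟨(measurable_corrEntry (K := fun _ => K) (fun _ _ _ => measurable_const) measurable_id
    t i a b).aestronglyMeasurable, ?_⟩
  refine lt_of_le_of_lt ?_ ((h.lintegral_state_sq_le_self t).trans_lt ENNReal.ofReal_lt_top)
  refine lintegral_mono fun z => ?_
  rw [Real.enorm_eq_ofReal_abs]
  exact ENNReal.ofReal_le_ofReal (abs_corrEntry_le K t i a b z)

lemma corrAt_apply (h : S.Bounded K M) (t : ℕ) (i : Fin N) (a b : Fin d) :
    S.corrAt K t i a b = ∫ z, S.corrEntry K t i a b z ∂S.baseLaw := by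
  have h1 : ∀ a b (z : EuclideanSpace ℝ (Fin d) × (ℕ → Fin N)),
      (if z.2 t = i then outer (S.state K z t) else 0) a b = S.corrEntry K t i a b z := by
    intro a b z
    unfold corrEntry
    split_ifs <;> rfl
  have h2 := Matrix.integral_apply (P := S.baseLaw)
    (f := fun z : EuclideanSpace ℝ (Fin d) × (ℕ → Fin N) =>
      if z.2 t = i then outer (S.state K z t) else 0)
    (fun a b => by simpa only [h1] using h.integrable_corrEntry t i a b) a b
  simp only [h1] at h2
  exact h2

lemma abs_corrAt_apply_le (h : S.Bounded K M) (t : ℕ) (i : Fin N) (a b : Fin d) :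
    |S.corrAt K t i a b| ≤ M ^ 5 * mjlsRate M ^ t := by
  have hM := h.pos
  have hρ := pow_nonneg (mjlsRate_pos h.one_le).le t
  rw [h.corrAt_apply, ← ENNReal.ofReal_le_ofReal_iff (by positivity), ← Real.enorm_eq_ofReal_abs]
  refine (enorm_integral_le_lintegral_enorm _).trans
    (le_trans (lintegral_mono fun z => ?_) (h.lintegral_state_sq_le_self t))
  rw [Real.enorm_eq_ofReal_abs]
  exact ENNReal.ofReal_le_ofReal (abs_corrEntry_le K t i a b z)

/-- Here 1 - ρ = 1/(4M³), whence the factor M⁵ · 4M³ = 4M⁸. -/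
lemma hasSum_rate (h : S.Bounded K M) (T : ℕ) :
    HasSum (fun t => M ^ 5 * mjlsRate M ^ (t + T)) (4 * M ^ 8 * mjlsRate M ^ T) := by
  have hM := h.pos
  have h1 := (hasSum_geometric_of_lt_one (mjlsRate_pos h.one_le).le
    (mjlsRate_lt_one h.one_le)).mul_left (M ^ 5 * mjlsRate M ^ T)
  have h2 : M ^ 5 * mjlsRate M ^ T * (1 - mjlsRate M)⁻¹ = 4 * M ^ 8 * mjlsRate M ^ T := by
    rw [show 1 - mjlsRate M = 1 / (4 * M ^ 3) by unfold mjlsRate; ring]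
    field_simp
  rw [h2] at h1
  refine h1.congr_fun fun t => ?_
  rw [pow_add]
  ring

lemma summable_corrAt_apply (h : S.Bounded K M) (i : Fin N) (a b : Fin d) :
    Summable fun t => S.corrAt K t i a b :=
  Summable.of_norm_bounded (h.hasSum_rate 0).summable fun t => h.abs_corrAt_apply_le t i a b

lemma corr_apply (h : S.Bounded K M) (i : Fin N) (a b : Fin d) :
    S.corr K i a b = ∑' t, S.corrAt K t i a b := by
  have h1 : HasSum (fun t => S.corrAt K t i) (Matrix.of fun a b => ∑' t, S.corrAt K t i a b) :=
    Pi.hasSum.2 fun a => Pi.hasSum.2 fun b => (h.summable_corrAt_apply i a b).hasSum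
  rw [corr, h1.tsum_eq]
  rfl

lemma abs_corr_sub_sum_le (h : S.Bounded K M) (T : ℕ) (i : Fin N) (a b : Fin d) :
    |∑ t ∈ Finset.range T, S.corrAt K t i a b - S.corr K i a b| ≤
      4 * M ^ 8 * mjlsRate M ^ T := by
  rw [h.corr_apply, ← (h.summable_corrAt_apply i a b).sum_add_tsum_nat_add T, sub_add_cancel_left,
    abs_neg]
  exact tsum_of_norm_bounded (f := fun t => S.corrAt K (t + T) i a b) (h.hasSum_rate T)
    fun t => h.abs_corrAt_apply_le (t + T) i a b

/-- Write y_a y_b - x_a x_b = y_a (y-x)_b + (y-x)_a x_b. Each product has one factor of order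
r(2M)^t and one of order (2M)^t. -/
lemma abs_corrEntry_sub_le (h : S.Bounded K M) {U : Matrix (Fin k) (Fin d) ℝ} {r : ℝ}
    (hr0 : 0 ≤ r) (hr1 : r ≤ 1)
    (hU : ∀ x : Fin d → ℝ, ‖WithLp.toLp 2 (U *ᵥ x)‖ ≤ r * ‖WithLp.toLp 2 x‖)
    (t : ℕ) (i : Fin N) (a b : Fin d) (z : EuclideanSpace ℝ (Fin d) × (ℕ → Fin N)) :
    |S.corrEntry (fun p => K p + U) t i a b z - S.corrEntry K t i a b z| ≤
      2 * r * (4 * M ^ 2) ^ t * ‖z.1‖ ^ 2 := by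
  have hM := h.pos
  unfold corrEntry
  split_ifs
  · set y := S.state (fun p => K p + U) z t
    set x := S.state K z t
    have hy : ‖WithLp.toLp 2 y‖ ≤ (2 * M) ^ t * ‖z.1‖ := h.norm_state_le hr1 hU z t
    have hx : ‖WithLp.toLp 2 x‖ ≤ (2 * M) ^ t * ‖z.1‖ := by
      simpa using h.norm_state_le (U := 0) zero_le_one (by simp) z t
    have he : ‖WithLp.toLp 2 (y - x)‖ ≤ r * (2 * M) ^ t * ‖z.1‖ :=
      h.norm_state_sub_le hr0 hr1 hU z t
    have hc : ∀ (v : Fin d → ℝ) c, |v c| ≤ ‖WithLp.toLp 2 v‖ :=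
      fun v c => PiLp.norm_apply_le (WithLp.toLp 2 v) c
    have h0 : y a * y b - x a * x b = y a * (y - x) b + (y - x) a * x b := by
      simp only [Pi.sub_apply]; ring
    rw [h0]
    refine (abs_add_le _ _).trans ?_
    rw [abs_mul, abs_mul]
    have h1 : |y a| * |(y - x) b| ≤ (2 * M) ^ t * ‖z.1‖ * (r * (2 * M) ^ t * ‖z.1‖) :=
      mul_le_mul ((hc _ _).trans hy) ((hc _ _).trans he) (abs_nonneg _) (by positivity)
    have h2 : |(y - x) a| * |x b| ≤ r * (2 * M) ^ t * ‖z.1‖ * ((2 * M) ^ t * ‖z.1‖) :=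
      mul_le_mul ((hc _ _).trans he) ((hc _ _).trans hx) (abs_nonneg _) (by positivity)
    have h3 : (4 * M ^ 2) ^ t = (2 * M) ^ t * (2 * M) ^ t := by
      rw [← mul_pow]; congr 1; ring
    rw [h3]
    linarith
  · rw [sub_self, abs_zero]; positivity

/-- Doubling the base absorbs the number of terms, as T ≤ 2^T. -/
lemma sum_pow_le (hM : 1 ≤ M) (T : ℕ) :
    ∑ t ∈ Finset.range T, (4 * M ^ 2) ^ t ≤ (8 * M ^ 2) ^ T := by
  have h1 : 1 ≤ 4 * M ^ 2 := by linarith [one_le_pow₀ hM (n := 2)]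
  calc ∑ t ∈ Finset.range T, (4 * M ^ 2) ^ t ≤ ∑ t ∈ Finset.range T, (4 * M ^ 2) ^ T :=
        Finset.sum_le_sum fun t ht => pow_le_pow_right₀ h1 (Finset.mem_range.1 ht).le
    _ = T * (4 * M ^ 2) ^ T := by rw [Finset.sum_const, Finset.card_range, nsmul_eq_mul]
    _ ≤ 2 ^ T * (4 * M ^ 2) ^ T := by
        gcongr
        exact_mod_cast Nat.lt_two_pow_self.le
    _ = _ := by rw [← mul_pow]; congr 1; ring

/-- The truncated estimator in one rollout has small bias. -/
lemma abs_integral_sub_corr_le (h : S.Bounded K M) (hd : 0 < d) (hk : 0 < k) {r : ℝ}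
    (hr0 : 0 ≤ r) (hr1 : r ≤ 1 / (4 * M ^ 6)) (T : ℕ) (i : Fin N) (a b : Fin d) :
    |∫ s, ∑ t ∈ Finset.range T, S.corrEntry (fun p => K p + toMat s.1) t i a b s.2
        ∂S.rolloutLaw r - S.corr K i a b| ≤
      2 * r * (8 * M ^ 2) ^ T * M ^ 2 + 4 * M ^ 8 * mjlsRate M ^ T := by
  have hM := h.pos
  have := isProbabilityMeasure_sphereLaw hd hk r
  have hr1' : r ≤ 1 := hr1.trans (by
    rw [div_le_one (by positivity)]; linarith [one_le_pow₀ h.one_le (n := 6)])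
  have hP : IsProbabilityMeasure (S.rolloutLaw (k := k) r) := by
    unfold rolloutLaw; infer_instance
  have hint : ∀ t, Integrable (fun s : EuclideanSpace ℝ (Fin k × Fin d) ×
      EuclideanSpace ℝ (Fin d) × (ℕ → Fin N) =>
      S.corrEntry (fun p => K p + toMat s.1) t i a b s.2) (S.rolloutLaw r) := fun t => by
    refine ⟨(measurable_corrEntry_rollout K t i a b).aestronglyMeasurable, ?_⟩
    refine lt_of_le_of_lt (lintegral_mono fun s => ?_)
      ((h.lintegral_rolloutLaw_state_sq_le hd hk hr0 hr1 t).trans_lt ENNReal.ofReal_lt_top)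
    rw [Real.enorm_eq_ofReal_abs]
    exact ENNReal.ofReal_le_ofReal (abs_corrEntry_le _ t i a b s.2)
  have hsnd : MeasurePreserving (Prod.snd : EuclideanSpace ℝ (Fin k × Fin d) ×
      EuclideanSpace ℝ (Fin d) × (ℕ → Fin N) → _) (S.rolloutLaw r) S.baseLaw := by
    unfold rolloutLaw; exact measurePreserving_snd
  have hint2 : ∀ t, Integrable (fun s : EuclideanSpace ℝ (Fin k × Fin d) ×
      EuclideanSpace ℝ (Fin d) × (ℕ → Fin N) => S.corrEntry K t i a b s.2) (S.rolloutLaw r) :=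
    fun t => hsnd.integrable_comp_of_integrable (h.integrable_corrEntry t i a b)
  have hcorr : ∀ t, S.corrAt K t i a b = ∫ s, S.corrEntry K t i a b s.2 ∂S.rolloutLaw r := by
    intro t
    rw [h.corrAt_apply, ← hsnd.map_eq, integral_map hsnd.measurable.aemeasurable]
    rw [hsnd.map_eq]
    exact (h.integrable_corrEntry t i a b).aestronglyMeasurable
  have hdiff : |∫ s, ∑ t ∈ Finset.range T, S.corrEntry (fun p => K p + toMat s.1) t i a b s.2
        ∂S.rolloutLaw r - ∑ t ∈ Finset.range T, S.corrAt K t i a b| ≤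
      2 * r * (8 * M ^ 2) ^ T * M ^ 2 := by
    simp_rw [hcorr]
    rw [← integral_finsetSum _ fun t _ => hint2 t, ← integral_sub
      (integrable_finsetSum _ fun t _ => hint t) (integrable_finsetSum _ fun t _ => hint2 t),
      ← ENNReal.ofReal_le_ofReal_iff (by positivity), ← Real.enorm_eq_ofReal_abs]
    refine (enorm_integral_le_lintegral_enorm _).trans ?_
    calc _ ≤ ∫⁻ s, ENNReal.ofReal (2 * r * (8 * M ^ 2) ^ T) * ENNReal.ofReal (‖s.2.1‖ ^ 2)
            ∂S.rolloutLaw r := by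
          have hae : ∀ᵐ s ∂S.rolloutLaw (k := k) r, ‖s.1‖ = r := by
            unfold rolloutLaw
            exact Measure.quasiMeasurePreserving_fst.ae (ae_sphereLaw_norm_eq hr0)
          refine lintegral_mono_ae ?_
          filter_upwards [hae] with s hs
          rw [Real.enorm_eq_ofReal_abs, ← ENNReal.ofReal_mul (by positivity),
            ← Finset.sum_sub_distrib]
          refine ENNReal.ofReal_le_ofReal ((Finset.abs_sum_le_sum_abs _ _).trans ?_)
          calc _ ≤ ∑ t ∈ Finset.range T, 2 * r * (4 * M ^ 2) ^ t * ‖s.2.1‖ ^ 2 :=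
                Finset.sum_le_sum fun t _ => h.abs_corrEntry_sub_le hr0 hr1'
                  (fun x => hs ▸ norm_toMat_mulVec_le s.1 x) t i a b s.2
            _ = 2 * r * (∑ t ∈ Finset.range T, (4 * M ^ 2) ^ t) * ‖s.2.1‖ ^ 2 := by
                rw [Finset.mul_sum, Finset.sum_mul]
            _ ≤ _ := by
                gcongr
                exact sum_pow_le h.one_le T
      _ ≤ ENNReal.ofReal (2 * r * (8 * M ^ 2) ^ T) * ENNReal.ofReal (M ^ 2) := by
          rw [lintegral_const_mul' _ _ ENNReal.ofReal_ne_top]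
          gcongr
          have h1 : MeasurePreserving (fun s : EuclideanSpace ℝ (Fin k × Fin d) ×
              EuclideanSpace ℝ (Fin d) × (ℕ → Fin N) => s.2.1) (S.rolloutLaw r) S.D := by
            have : MeasurePreserving (Prod.fst : EuclideanSpace ℝ (Fin d) × (ℕ → Fin N) → _)
              S.baseLaw S.D := by unfold baseLaw; exact measurePreserving_fst
            exact this.comp hsnd
          rw [h1.lintegral_comp (f := fun x => ENNReal.ofReal (‖x‖ ^ 2)) (by fun_prop)]
          exact h.lintegral_norm_sq_le
      _ = _ := by rw [← ENNReal.ofReal_mul (by positivity)]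
  -- The intermediate quantity separates the bias of the perturbed gain from that of truncating the
  -- series at T.
  calc _ ≤ _ := abs_sub_le _ (∑ t ∈ Finset.range T, S.corrAt K t i a b) _
    _ ≤ _ := add_le_add hdiff (h.abs_corr_sub_sum_le T i a b)

end Bounded

end MJLS

/-! ### Chebyshev and Markov for independent samples -/

section EmpiricalMean

variable {Ω : Type*} [MeasurableSpace Ω] {P : Measure Ω} [IsProbabilityMeasure P]

/-- Chebyshev's inequality for the empirical mean of a bounded function. -/
lemma meas_le_abs_mean_sub_integral_le {X : Ω → ℝ} (hX : Measurable X) {b c : ℝ}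
    (hb : ∀ᵐ w ∂P, |X w| ≤ b) (hc : 0 < c) {m : ℕ} (hm : 0 < m) :
    (Measure.pi fun _ : Fin m => P) {s | c ≤ |1 / (m : ℝ) * ∑ j, X (s j) - ∫ w, X w ∂P|} ≤
      ENNReal.ofReal (b ^ 2 / (m * c ^ 2)) := by
  have hm' : (0 : ℝ) < m := by exact_mod_cast hm
  have hL : MemLp X 2 P := MemLp.of_bound hX.aestronglyMeasurable b hb
  have hmp : ∀ j : Fin m, MeasurePreserving (Function.eval j)
    (Measure.pi fun _ : Fin m => P) P := fun j => measurePreserving_eval (fun _ : Fin m => P) j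
  have hLj : ∀ j : Fin m, MemLp (fun s : Fin m → Ω => X (s j)) 2 (Measure.pi fun _ : Fin m => P) :=
    fun j => hL.comp_measurePreserving (hmp j)
  have hS : MemLp (∑ j, fun s : Fin m → Ω => X (s j)) 2 (Measure.pi fun _ : Fin m => P) :=
    memLp_finsetSum' _ fun j _ => hLj j
  have hE : ∫ s, (∑ j, fun s : Fin m → Ω => X (s j)) s ∂(Measure.pi fun _ : Fin m => P) =
      m * ∫ w, X w ∂P := by
    simp only [Finset.sum_apply]
    rw [integral_finsetSum _ fun j _ => (hLj j).integrable one_le_two]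
    have : ∀ j : Fin m, ∫ s, X (s j) ∂(Measure.pi fun _ : Fin m => P) = ∫ w, X w ∂P := fun j => by
      have h1 := integral_map (μ := Measure.pi fun _ : Fin m => P) (f := X)
        (hmp j).measurable.aemeasurable (by rw [(hmp j).map_eq]; exact hX.aestronglyMeasurable)
      rw [(hmp j).map_eq] at h1
      exact h1.symm
    simp [this]
  have hV : Var[∑ j, fun s : Fin m → Ω => X (s j); Measure.pi fun _ : Fin m => P] ≤ m * b ^ 2 := by
    rw [variance_sum_pi (X := fun _ : Fin m => X) fun _ => hL]
    simp only [Finset.sum_const, Finset.card_univ, Fintype.card_fin, nsmul_eq_mul]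
    gcongr
    -- Popoviciu's inequality on [-b, b].
    have := variance_le_sq_of_bounded (μ := P) (a := -b) (b := b)
      (hb.mono fun w hw => abs_le.1 hw) hX.aemeasurable
    calc _ ≤ _ := this
      _ = b ^ 2 := by ring
  have hcm : 0 < m * c := by positivity
  refine le_trans (measure_mono fun s hs => ?_)
    ((meas_ge_le_variance_div_sq hS hcm).trans (ENNReal.ofReal_le_ofReal ?_))
  · simp only [Set.mem_ofPred_eq] at hs ⊢
    rw [hE, Finset.sum_apply]
    have : ∑ j, X (s j) - m * ∫ w, X w ∂P =
        m * (1 / (m : ℝ) * ∑ j, X (s j) - ∫ w, X w ∂P) := by field_simp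
    rw [this, abs_mul, abs_of_pos hm']
    gcongr
  · calc _ ≤ m * b ^ 2 / (m * c) ^ 2 := by gcongr
      _ = _ := by field_simp

/-- Markov's inequality for the empirical mean of a nonnegative function. -/
lemma meas_le_mean_le {g : Ω → ℝ} (hg : Measurable g) (hg0 : ∀ w, 0 ≤ g w) {e c : ℝ}
    (he : ∫⁻ w, ENNReal.ofReal (g w) ∂P ≤ ENNReal.ofReal e) (hc : 0 < c) {m : ℕ} (hm : 0 < m) :
    (Measure.pi fun _ : Fin m => P) {s | c ≤ 1 / (m : ℝ) * ∑ j, g (s j)} ≤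
      ENNReal.ofReal (e / c) := by
  have hm' : (0 : ℝ) < m := by exact_mod_cast hm
  have hmeas : Measurable fun s : Fin m → Ω => ENNReal.ofReal (1 / (m : ℝ) * ∑ j, g (s j)) := by
    fun_prop
  have hI : ∫⁻ s, ENNReal.ofReal (1 / (m : ℝ) * ∑ j, g (s j)) ∂(Measure.pi fun _ : Fin m => P) ≤
      ENNReal.ofReal e := by
    have h1 : ∀ s : Fin m → Ω, ENNReal.ofReal (1 / (m : ℝ) * ∑ j, g (s j)) =
        ENNReal.ofReal (1 / (m : ℝ)) * ∑ j, ENNReal.ofReal (g (s j)) := fun s => by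
      rw [ENNReal.ofReal_mul (by positivity), ENNReal.ofReal_sum_of_nonneg fun j _ => hg0 _]
    simp_rw [h1]
    rw [lintegral_const_mul' _ _ ENNReal.ofReal_ne_top, lintegral_finsetSum _ fun j _ =>
      show Measurable fun s : Fin m → Ω => ENNReal.ofReal (g (s j)) from by fun_prop]
    have h2 : ∀ j : Fin m, ∫⁻ s, ENNReal.ofReal (g (s j)) ∂(Measure.pi fun _ : Fin m => P) =
        ∫⁻ w, ENNReal.ofReal (g w) ∂P := fun j =>
      (measurePreserving_eval (fun _ : Fin m => P) j).lintegral_comp hg.ennreal_ofReal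
    simp only [h2, Finset.sum_const, Finset.card_univ, Fintype.card_fin, nsmul_eq_mul]
    rw [← mul_assoc, ← ENNReal.ofReal_natCast, ← ENNReal.ofReal_mul (by positivity),
      one_div_mul_cancel hm'.ne', ENNReal.ofReal_one, one_mul]
    exact he
  calc _ ≤ (Measure.pi fun _ : Fin m => P)
        {s | ENNReal.ofReal c ≤ ENNReal.ofReal (1 / (m : ℝ) * ∑ j, g (s j))} :=
        measure_mono fun s hs => ENNReal.ofReal_le_ofReal hs
    _ ≤ (∫⁻ s, ENNReal.ofReal (1 / (m : ℝ) * ∑ j, g (s j)) ∂(Measure.pi fun _ : Fin m => P)) /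
        ENNReal.ofReal c := meas_ge_le_lintegral_div hmeas.aemeasurable
        (ENNReal.ofReal_pos.2 hc).ne' ENNReal.ofReal_ne_top
    _ ≤ _ := by
        rw [ENNReal.ofReal_div_of_pos hc]
        gcongr

end EmpiricalMean

/-! ### Error decomposition and union bound -/

namespace MJLS

variable {d k N : ℕ} {S : MJLS d k N} {K : Policy d k N} {M : ℝ}

lemma corrEst_apply (l m : ℕ)
    (s : Fin m → EuclideanSpace ℝ (Fin k × Fin d) × EuclideanSpace ℝ (Fin d) × (ℕ → Fin N))
    (i : Fin N) (a b : Fin d) :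
    S.corrEst K l m s i a b = 1 / (m : ℝ) * ∑ j, ∑ t ∈ Finset.range l,
      S.corrEntry (fun p => K p + toMat (s j).1) t i a b (s j).2 := by
  rw [corrEst, Matrix.smul_apply, smul_eq_mul, Matrix.sum_apply]
  congr 1
  refine Finset.sum_congr rfl fun j _ => ?_
  rw [Matrix.sum_apply]
  refine Finset.sum_congr rfl fun t _ => ?_
  unfold corrEntry
  split_ifs <;> rfl

lemma tupleNorm_le {V : Fin N → Matrix (Fin d) (Fin d) ℝ} {c : ℝ}
    (hV : ∀ i a b, |V i a b| ≤ c) : tupleNorm V ≤ N * d ^ 2 * c := by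
  calc tupleNorm V ≤ ∑ _i : Fin N, ∑ _a : Fin d, ∑ _b : Fin d, c :=
        Finset.sum_le_sum fun i _ => (l2_opNorm_le_sum_abs _).trans
          (Finset.sum_le_sum fun a _ => Finset.sum_le_sum fun b _ => hV i a b)
    _ = _ := by simp; ring

namespace Bounded

/-- Summing the geometric decay gives a bound free of `n`, which is what allows arbitrarily long
rollouts. -/
lemma lintegral_tail_le (h : S.Bounded K M) (hd : 0 < d) (hk : 0 < k) {r : ℝ}
    (hr0 : 0 ≤ r) (hr : r ≤ 1 / (4 * M ^ 6)) (T n : ℕ) :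
    ∫⁻ s, ENNReal.ofReal (∑ t ∈ Finset.range n,
      S.state (fun p => K p + toMat s.1) s.2 (T + t) ⬝ᵥ
        S.state (fun p => K p + toMat s.1) s.2 (T + t)) ∂S.rolloutLaw r ≤
        ENNReal.ofReal (4 * M ^ 8 * mjlsRate M ^ T) := by
  have hM := h.pos
  have hρ := (mjlsRate_pos h.one_le).le
  simp_rw [ENNReal.ofReal_sum_of_nonneg fun _ _ => dotProduct_self_nonneg' _]
  rw [lintegral_finsetSum _ fun t _ => (measurable_state_sq_rollout K (T + t)).ennreal_ofReal]
  refine (Finset.sum_le_sum fun t _ =>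
    h.lintegral_rolloutLaw_state_sq_le hd hk hr0 hr (T + t)).trans ?_
  rw [← ENNReal.ofReal_sum_of_nonneg fun t _ => by positivity]
  refine ENNReal.ofReal_le_ofReal ?_
  simp_rw [add_comm T]
  exact sum_le_hasSum _ (fun t _ => by positivity) (h.hasSum_rate T)

lemma ae_abs_sum_corrEntry_le (h : S.Bounded K M) (hd : 0 < d) (hk : 0 < k) {L : ℝ}
    (hL : ∀ᵐ x ∂S.D, ‖x‖ ≤ L) {r : ℝ} (hr0 : 0 ≤ r) (hr1 : r ≤ 1)
    (T : ℕ) (i : Fin N) (a b : Fin d) :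
    ∀ᵐ s ∂S.rolloutLaw (k := k) r, |∑ t ∈ Finset.range T,
      S.corrEntry (fun p => K p + toMat s.1) t i a b s.2| ≤ (8 * M ^ 2) ^ T * L ^ 2 := by
  have hM := h.pos
  have := isProbabilityMeasure_sphereLaw hd hk r
  have h1 : ∀ᵐ s ∂S.rolloutLaw (k := k) r, ‖s.1‖ = r := by
    unfold rolloutLaw
    exact Measure.quasiMeasurePreserving_fst.ae (ae_sphereLaw_norm_eq hr0)
  have h2 : ∀ᵐ s ∂S.rolloutLaw (k := k) r, ‖s.2.1‖ ≤ L := by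
    unfold rolloutLaw baseLaw
    exact Measure.quasiMeasurePreserving_snd.ae (Measure.quasiMeasurePreserving_fst.ae hL)
  filter_upwards [h1, h2] with s hs1 hs2
  refine (Finset.abs_sum_le_sum_abs _ _).trans ?_
  calc _ ≤ ∑ t ∈ Finset.range T, (4 * M ^ 2) ^ t * L ^ 2 := by
        refine Finset.sum_le_sum fun t _ => (abs_corrEntry_le _ t i a b s.2).trans ?_
        rw [← norm_toLp_sq]
        have h3 := h.norm_state_le hr1 (fun x => hs1 ▸ norm_toMat_mulVec_le s.1 x) s.2 t
        calc _ ≤ ((2 * M) ^ t * L) ^ 2 := by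
              gcongr
              exact h3.trans (by gcongr)
          _ = _ := by rw [mul_pow, ← pow_mul, mul_comm t 2, pow_mul]; ring
    _ = (∑ t ∈ Finset.range T, (4 * M ^ 2) ^ t) * L ^ 2 := by rw [Finset.sum_mul]
    _ ≤ _ := by
        gcongr
        exact sum_pow_le h.one_le T

/-- The estimator is accurate with high probability, given a truncation time `T`. -/
lemma le_measure_tupleNorm_le (h : S.Bounded K M) (hd : 0 < d) (hk : 0 < k) {L : ℝ}
    (hL : ∀ᵐ x ∂S.D, ‖x‖ ≤ L) {r : ℝ} (hr0 : 0 ≤ r) (hr : r ≤ 1 / (4 * M ^ 6))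
    {T l m : ℕ} (hT : T ≤ l) (hm : 0 < m) {c ε δ : ℝ} (hc : 0 < c)
    (hbias : 2 * r * (8 * M ^ 2) ^ T * M ^ 2 + 4 * M ^ 8 * mjlsRate M ^ T ≤ c)
    (hε : N * d ^ 2 * (3 * c) ≤ ε)
    (hδ : N * d ^ 2 * (((8 * M ^ 2) ^ T * L ^ 2) ^ 2 / (m * c ^ 2)) +
      4 * M ^ 8 * mjlsRate M ^ T / c ≤ δ) :
    ENNReal.ofReal (1 - δ) ≤ (Measure.pi fun _ : Fin m => S.rolloutLaw r)
      {s | tupleNorm (fun i => S.corrEst K l m s i - S.corr K i) ≤ ε} := by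
  have hM := h.pos
  have hρ := (mjlsRate_pos h.one_le).le
  have := isProbabilityMeasure_sphereLaw hd hk r
  have hP : IsProbabilityMeasure (S.rolloutLaw (k := k) r) := by
    unfold rolloutLaw; infer_instance
  have hr1 : r ≤ 1 := hr.trans (by
    rw [div_le_one (by positivity)]; linarith [one_le_pow₀ h.one_le (n := 6)])
  obtain ⟨n, rfl⟩ := Nat.exists_eq_add_of_le hT
  set P := Measure.pi fun _ : Fin m => S.rolloutLaw (k := k) r
  let X : Fin N → Fin d → Fin d →
      EuclideanSpace ℝ (Fin k × Fin d) × EuclideanSpace ℝ (Fin d) × (ℕ → Fin N) → ℝ :=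
    fun i a b s => ∑ t ∈ Finset.range T, S.corrEntry (fun p => K p + toMat s.1) t i a b s.2
  let g : EuclideanSpace ℝ (Fin k × Fin d) × EuclideanSpace ℝ (Fin d) × (ℕ → Fin N) → ℝ :=
    fun s => ∑ t ∈ Finset.range n, S.state (fun p => K p + toMat s.1) s.2 (T + t) ⬝ᵥ
        S.state (fun p => K p + toMat s.1) s.2 (T + t)
  let good := {s | tupleNorm (fun i => S.corrEst K (T + n) m s i - S.corr K i) ≤ ε}
  let bad : Fin N × Fin d × Fin d → Set (Fin m → EuclideanSpace ℝ (Fin k × Fin d) ×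
      EuclideanSpace ℝ (Fin d) × (ℕ → Fin N)) := fun q =>
    {s | c ≤ |1 / (m : ℝ) * ∑ j, X q.1 q.2.1 q.2.2 (s j) -
      ∫ w, X q.1 q.2.1 q.2.2 w ∂S.rolloutLaw r|}
  let tail := {s : Fin m → EuclideanSpace ℝ (Fin k × Fin d) ×
      EuclideanSpace ℝ (Fin d) × (ℕ → Fin N) | c ≤ 1 / (m : ℝ) * ∑ j, g (s j)}
  -- Off the bad events every entry has three errors of size at most `c`: the fluctuation before T,
  -- the contribution of times from T on, and the bias.
  have hsub : goodᶜ ⊆ (⋃ q, bad q) ∪ tail := by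
    intro s hs
    by_contra hns
    simp only [Set.mem_union, Set.mem_iUnion, not_or, not_exists] at hns
    obtain ⟨hb, ht⟩ := hns
    refine hs ((tupleNorm_le (c := 3 * c) fun i a b => ?_).trans hε)
    have h1 : |1 / (m : ℝ) * ∑ j, X i a b (s j) - ∫ w, X i a b w ∂S.rolloutLaw r| < c :=
      not_le.1 (hb (i, a, b))
    have h2 : 1 / (m : ℝ) * ∑ j, g (s j) < c := not_le.1 ht
    have h3 := (h.abs_integral_sub_corr_le hd hk hr0 hr T i a b).trans hbias
    have h4 : |1 / (m : ℝ) * ∑ j, ∑ t ∈ Finset.range n,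
        S.corrEntry (fun p => K p + toMat (s j).1) (T + t) i a b (s j).2| ≤
        1 / (m : ℝ) * ∑ j, g (s j) := by
      rw [abs_mul, abs_of_nonneg (by positivity : 0 ≤ 1 / (m : ℝ))]
      gcongr
      refine (Finset.abs_sum_le_sum_abs _ _).trans (Finset.sum_le_sum fun j _ => ?_)
      exact (Finset.abs_sum_le_sum_abs _ _).trans (Finset.sum_le_sum fun t _ =>
        abs_corrEntry_le _ _ i a b _)
    have h5 : (S.corrEst K (T + n) m s i - S.corr K i) a b =
        (1 / (m : ℝ) * ∑ j, X i a b (s j) - ∫ w, X i a b w ∂S.rolloutLaw r) +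
        1 / (m : ℝ) * ∑ j, ∑ t ∈ Finset.range n,
          S.corrEntry (fun p => K p + toMat (s j).1) (T + t) i a b (s j).2 +
        (∫ w, X i a b w ∂S.rolloutLaw r - S.corr K i a b) := by
      rw [Matrix.sub_apply, corrEst_apply]
      simp_rw [Finset.sum_range_add, Finset.sum_add_distrib]
      ring
    rw [h5]
    refine (abs_add_three _ _ _).trans ?_
    linarith
  have hbad : ∀ q, P (bad q) ≤ ENNReal.ofReal (((8 * M ^ 2) ^ T * L ^ 2) ^ 2 / (m * c ^ 2)) :=
    fun q => meas_le_abs_mean_sub_integral_le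
      (Finset.measurable_sum _ fun t _ => measurable_corrEntry_rollout K t _ _ _)
      (h.ae_abs_sum_corrEntry_le hd hk hL hr0 hr1 T _ _ _) hc hm
  have htail : P tail ≤ ENNReal.ofReal (4 * M ^ 8 * mjlsRate M ^ T / c) :=
    meas_le_mean_le (Finset.measurable_sum _ fun t _ => measurable_state_sq_rollout K (T + t))
      (fun s => Finset.sum_nonneg fun t _ => dotProduct_self_nonneg' _)
      (h.lintegral_tail_le hd hk hr0 hr T n) hc hm
  have hcompl : P goodᶜ ≤ ENNReal.ofReal δ := by
    calc P goodᶜ ≤ ∑ q, P (bad q) + P tail :=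
          (measure_mono hsub).trans ((measure_union_le _ _).trans
            (add_le_add_left (measure_iUnion_fintype_le _ _) _))
      _ ≤ ∑ _q : Fin N × Fin d × Fin d,
            ENNReal.ofReal (((8 * M ^ 2) ^ T * L ^ 2) ^ 2 / (m * c ^ 2)) +
            ENNReal.ofReal (4 * M ^ 8 * mjlsRate M ^ T / c) :=
          add_le_add (Finset.sum_le_sum fun q _ => hbad q) htail
      _ = ENNReal.ofReal (N * d ^ 2 * (((8 * M ^ 2) ^ T * L ^ 2) ^ 2 / (m * c ^ 2)) +
            4 * M ^ 8 * mjlsRate M ^ T / c) := by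
          rw [← ENNReal.ofReal_sum_of_nonneg fun _ _ => by positivity,
            ← ENNReal.ofReal_add (Finset.sum_nonneg fun _ _ => by positivity) (by positivity)]
          congr 2
          simp [sq, mul_assoc]
      _ ≤ ENNReal.ofReal δ := ENNReal.ofReal_le_ofReal hδ
  -- Subadditivity suffices, so measurability of `good` is not needed.
  have huniv : 1 ≤ P good + P goodᶜ := by
    rw [← measure_univ (μ := P), ← Set.union_compl_self good]
    exact measure_union_le _ _
  have hδ0 : 0 ≤ δ := le_trans (by positivity) hδ
  rw [ENNReal.ofReal_sub _ hδ0, ENNReal.ofReal_one]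
  exact tsub_le_iff_right.2 (huniv.trans (add_le_add_right hcompl _))

end Bounded

end MJLS

/-! ### Choice of the parameters and the polynomials -/

/-- A time at which a geometric decay is below `η` and a geometric growth is polynomial
in `1 / η`. -/
lemma exists_pow_le_and_pow_le {ρ G η : ℝ} {p : ℕ} (hρ0 : 0 < ρ) (hρ1 : ρ < 1) (hG : 1 ≤ G)
    (hp : G * ρ ^ p ≤ 1) (hη : 0 < η) :
    ∃ T : ℕ, ρ ^ T ≤ η ∧ G ^ T ≤ G * (1 / η) ^ p + 1 := by
  classical
  have hex : ∃ T : ℕ, ρ ^ T ≤ η := (exists_pow_lt_of_lt_one hη hρ1).imp fun _ => le_of_lt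
  refine ⟨Nat.find hex, Nat.find_spec hex, ?_⟩
  have hG0 : 0 < G := one_pos.trans_le hG
  rcases hT : Nat.find hex with _ | t
  · rw [pow_zero]
    have : 0 ≤ G * (1 / η) ^ p := by positivity
    linarith
  -- Minimality of T = t + 1 gives η < ρ^t, and G ≤ ρ^(-p) turns this into G^t ≤ η^(-p). The last
  -- step costs one more factor G.
  · have ht : η < ρ ^ t := not_le.1 (Nat.find_min hex (by omega))
    have h1 : G ^ t ≤ (1 / η) ^ p := by
      calc G ^ t ≤ (1 / ρ ^ p) ^ t := by
            gcongr
            rw [le_div_iff₀ (by positivity)]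
            exact hp
        _ = (1 / ρ ^ t) ^ p := by rw [div_pow, div_pow, one_pow, one_pow, ← pow_mul, ← pow_mul,
            mul_comm]
        _ ≤ (1 / η) ^ p := by gcongr
    rw [pow_succ']
    have := mul_le_mul_of_nonneg_left h1 hG0.le
    linarith

/-- The bound 1 ≤ M is forced by 1 ≤ N d ≤ M³. -/
lemma MJLS.bounded_of_le {d k N : ℕ} (hd : 0 < d) {S : MJLS d k N} {K : Policy d k N} {M L : ℝ}
    (hM : 0 < M) (hB : ∀ i, ‖S.B i‖ ≤ M) (hA : ∀ i, ‖S.A i - S.B i * K i‖ ≤ M)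
    (hC : S.cost K ≤ ENNReal.ofReal M) (hQ : 1 / M ≤ lambdaMin S.Q) (hμ : 1 / M ≤ S.mu)
    (hL : ∀ᵐ x ∂S.D, ‖x‖ ≤ L) : S.Bounded K M := by
  refine ⟨?_, hB, hA, hC, hQ, hμ, L, hL⟩
  have h1 := S.card_mul_dim_le hL hM hC hQ hμ
  have h2 : (1 : ℝ) ≤ d := by exact_mod_cast hd
  have h3 : (1 : ℝ) ≤ N := by exact_mod_cast S.mode_pos
  by_contra! hlt
  have : M ^ 3 < 1 := pow_lt_one₀ hM.le hlt (by norm_num)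
  nlinarith

/-- The sample complexity bound, with explicit rates; `D` bounds the number of modes times the
dimension. -/
lemma MJLS.Bounded.le_measure_of_rates {d k N : ℕ} {S : MJLS d k N} {K : Policy d k N}
    {M L ε r : ℝ} {D p l m : ℕ} (h : S.Bounded K M) (hd : 0 < d) (hk : 0 < k)
    (hL : ∀ᵐ x ∂S.D, ‖x‖ ≤ L) (hD : M ^ 3 ≤ D) (hp : 8 * M ^ 2 * mjlsRate M ^ p ≤ 1)
    (hε : 0 < ε) (hr0 : 0 < r) {W : ℝ}
    (hW : W = 8 * M ^ 2 * (24 * M ^ 8 * D ^ (D + 2) * (1 / ε) ^ (D + 1)) ^ p + 1)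
    (hr : r ≤ 1 / (12 * D ^ 2 * M ^ 2 * W * (1 / ε) + 4 * M ^ 6)) (hl : W ≤ l)
    (hm : 18 * D ^ 6 * M ^ 4 * W ^ 2 * (L ^ 2 / S.mu) ^ 2 * (1 / ε) ^ 2 * (D * (1 / ε)) ^ D + 1
      ≤ m) :
    ENNReal.ofReal (1 - ((d : ℝ) / ε) ^ (-(d : ℤ))) ≤
      (MeasureTheory.Measure.pi fun _ : Fin m => S.rolloutLaw r)
        {s | tupleNorm (fun i => S.corrEst K l m s i - S.corr K i) ≤ ε} := by
  have hM := h.pos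
  have hM1 := h.one_le
  have hd1 : (1 : ℝ) ≤ d := by exact_mod_cast hd
  have hN1 : (1 : ℝ) ≤ N := by exact_mod_cast S.mode_pos
  have hδ_eq : ((d : ℝ) / ε) ^ (-(d : ℤ)) = (ε / d) ^ d := by
    rw [_root_.zpow_neg, zpow_natCast, ← inv_pow, inv_div]
  rw [hδ_eq]
  -- For ε ≥ d the claimed probability is at most 0.
  rcases le_or_gt (d : ℝ) ε with hεd | hεd
  · have : 1 ≤ (ε / d) ^ d := one_le_pow₀ ((one_le_div (by positivity)).2 hεd)
    rw [ENNReal.ofReal_of_nonpos (by linarith)]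
    exact zero_le
  have hND : (N : ℝ) * d ≤ D := (S.card_mul_dim_le hL hM h.cost_le h.le_Q h.le_mu).trans hD
  have hdD : (d : ℝ) ≤ D := by nlinarith
  have hdD' : d ≤ D := by exact_mod_cast hdD
  have hD0 : (0 : ℝ) < D := by linarith
  have hNd2 : (N : ℝ) * d ^ 2 ≤ D ^ 2 := by
    calc (N : ℝ) * d ^ 2 = N * d * d := by ring
      _ ≤ D * D := by gcongr
      _ = _ := by ring
  -- A smaller failure probability with the fixed exponent D, so that 1/κ is polynomial in 1/ε.
  set κ : ℝ := (ε / D) ^ D with hκ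
  have hκ0 : 0 < κ := by positivity
  have hκδ : κ ≤ (ε / d) ^ d := by
    calc κ ≤ (ε / d) ^ D := by rw [hκ]; gcongr
      _ ≤ (ε / d) ^ d := pow_le_pow_of_le_one (by positivity)
          ((div_le_one (by positivity)).2 hεd.le) hdD'
  have hκ1 : κ ≤ 1 := pow_le_one₀ (by positivity) ((div_le_one hD0).2 (hεd.le.trans hdD))
  -- Chosen so that 4M⁸η = cκ/2 for c = ε/(3D²): Markov uses half of the failure probability κ,
  -- leaving the other half to Chebyshev.
  set η : ℝ := ε * κ / (24 * M ^ 8 * D ^ 2) with hη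
  have hη0 : 0 < η := by positivity
  have hη_inv : 1 / η = 24 * M ^ 8 * D ^ (D + 2) * (1 / ε) ^ (D + 1) := by
    rw [hη, hκ, div_pow, pow_add (D : ℝ) D 2, div_pow 1 ε, one_pow, pow_succ ε D]
    field_simp
  have hG : 1 ≤ 8 * M ^ 2 := by linarith [one_le_pow₀ hM1 (n := 2)]
  obtain ⟨T, hTη, hTW⟩ := exists_pow_le_and_pow_le (mjlsRate_pos hM1) (mjlsRate_lt_one hM1) hG hp hη0
  rw [hη_inv, ← hW] at hTW
  have hW0 : 0 < W := lt_of_lt_of_le (by positivity) hTW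
  -- Since T ≤ 2^T ≤ (8M²)^T ≤ W, the same W bounds the growth and the truncation time.
  have hTl : T ≤ l := by
    have h1 : (T : ℝ) ≤ 2 ^ T := by exact_mod_cast Nat.lt_two_pow_self.le
    have h2 : (2 : ℝ) ^ T ≤ (8 * M ^ 2) ^ T := by
      gcongr
      linarith [one_le_pow₀ hM1 (n := 2)]
    exact_mod_cast ((h1.trans h2).trans hTW).trans hl
  have hμ0 : 0 < S.mu := lt_of_lt_of_le (by positivity) h.le_mu
  have hmpos : (1 : ℝ) ≤ m := le_trans (le_add_of_nonneg_left (by positivity)) hm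
  have hm0 : 0 < m := by exact_mod_cast hmpos
  have hL2 : L ^ 2 ≤ M ^ 2 * (L ^ 2 / S.mu) := by
    rw [mul_div_assoc', le_div_iff₀ hμ0, mul_comm]
    exact mul_le_mul_of_nonneg_right (S.mu_le hd hL hM h.cost_le h.le_Q) (sq_nonneg L)
  have hr6 : r ≤ 1 / (4 * M ^ 6) := hr.trans
    (one_div_le_one_div_of_le (by positivity) (le_add_of_nonneg_left (by positivity)))
  have hrW : r ≤ 1 / (12 * D ^ 2 * M ^ 2 * W * (1 / ε)) := hr.trans
    (one_div_le_one_div_of_le (by positivity) (le_add_of_nonneg_right (by positivity)))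
  have htail : 4 * M ^ 8 * mjlsRate M ^ T ≤ ε * κ / (6 * D ^ 2) := by
    calc _ ≤ 4 * M ^ 8 * η := by gcongr
      _ = _ := by rw [hη]; field_simp; norm_num
  -- Three errors of size c in each of N d² ≤ D² entries add up to at most ε.
  refine le_trans (ENNReal.ofReal_le_ofReal (by linarith))
    (h.le_measure_tupleNorm_le hd hk hL hr0.le hr6 hTl hm0 (c := ε / (3 * D ^ 2)) (ε := ε) (δ := κ)
      (by positivity) ?_ ?_ ?_)
  · have h1 : 2 * r * (8 * M ^ 2) ^ T * M ^ 2 ≤ ε / (6 * D ^ 2) := by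
      calc _ ≤ 2 * (1 / (12 * D ^ 2 * M ^ 2 * W * (1 / ε))) * W * M ^ 2 := by gcongr
        _ = _ := by field_simp; norm_num
    have h2 : ε * κ / (6 * D ^ 2) ≤ ε / (6 * D ^ 2) := by
      gcongr
      exact mul_le_of_le_one_right hε.le hκ1
    have h3 : ε / (3 * (D : ℝ) ^ 2) = ε / (6 * D ^ 2) + ε / (6 * D ^ 2) := by field_simp; norm_num
    linarith
  · calc _ ≤ (D : ℝ) ^ 2 * (3 * (ε / (3 * D ^ 2))) := by gcongr
      _ = ε := by field_simp
  · have h1 : 4 * M ^ 8 * mjlsRate M ^ T / (ε / (3 * D ^ 2)) ≤ κ / 2 := by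
      calc _ ≤ ε * κ / (6 * D ^ 2) / (ε / (3 * D ^ 2)) := by gcongr
        _ = κ / 2 := by field_simp; norm_num
    have h2 : (N : ℝ) * d ^ 2 * (((8 * M ^ 2) ^ T * L ^ 2) ^ 2 / (m * (ε / (3 * D ^ 2)) ^ 2)) ≤
        κ / 2 := by
      have hκ_inv : (D * (1 / ε)) ^ D = 1 / κ := by
        rw [hκ, one_div, one_div, ← inv_pow, inv_div, div_eq_mul_inv]
      rw [hκ_inv] at hm
      have h3 : 18 * D ^ 6 * (W * (M ^ 2 * (L ^ 2 / S.mu))) ^ 2 / (ε ^ 2 * κ) ≤ m := by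
        calc _ = 18 * D ^ 6 * M ^ 4 * W ^ 2 * (L ^ 2 / S.mu) ^ 2 * (1 / ε) ^ 2 * (1 / κ) := by
              field_simp
          _ ≤ m := (le_add_of_nonneg_right zero_le_one).trans hm
      rw [div_le_iff₀ (by positivity)] at h3
      calc _ ≤ (D : ℝ) ^ 2 * ((W * (M ^ 2 * (L ^ 2 / S.mu))) ^ 2 /
              (m * (ε / (3 * D ^ 2)) ^ 2)) := by gcongr
        _ = (9 * D ^ 6 * (W * (M ^ 2 * (L ^ 2 / S.mu))) ^ 2) / (m * ε ^ 2) := by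
            rw [div_pow, mul_pow 3]
            generalize (W * (M ^ 2 * (L ^ 2 / S.mu))) ^ 2 = Z
            field_simp
            norm_num
        _ ≤ κ / 2 := by
            rw [div_le_div_iff₀ (by positivity) (by norm_num)]
            linarith
    linarith

/-- The polynomials `fr`, `fl`, `fs` depend only on a common bound `M` for the quantities
`‖B_i‖`, `‖A_i - B_i K_i‖`, `C(K)`, `1 / Λ_min(Q)` and `1 / μ` of the problem. -/
theorem mainTheorem9 (M : ℝ) (hM : 0 < M) :
    ∃ (fr : Polynomial ℝ) (fl : MvPolynomial (Fin 2) ℝ) (fs : MvPolynomial (Fin 3) ℝ),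
      (∀ y : ℝ, 0 < y → 0 < fr.eval y) ∧
      ∀ (d k N : ℕ), 0 < d → 0 < k →
      ∀ (S : MJLS d k N) (K : Policy d k N),
        (∀ i, ‖S.B i‖ ≤ M) →
        (∀ i, ‖S.A i - S.B i * K i‖ ≤ M) →
        S.cost K ≤ ENNReal.ofReal M →
        1 / M ≤ lambdaMin S.Q →
        1 / M ≤ S.mu →
      ∀ L : ℝ, (∀ᵐ x ∂S.D, ‖x‖ ≤ L) →
      ∀ ε : ℝ, 0 < ε →
      ∀ r : ℝ, 0 < r → r ≤ 1 / fr.eval (1 / ε) →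
      ∀ l : ℕ, MvPolynomial.eval ![(d : ℝ), 1 / ε] fl ≤ (l : ℝ) →
      ∀ m : ℕ, MvPolynomial.eval ![(d : ℝ), 1 / ε, L ^ 2 / S.mu] fs ≤ (m : ℝ) →
        ENNReal.ofReal (1 - ((d : ℝ) / ε) ^ (-(d : ℤ))) ≤
          (MeasureTheory.Measure.pi fun _ : Fin m => S.rolloutLaw r)
            {s | tupleNorm (fun i => S.corrEst K l m s i - S.corr K i) ≤ ε} := by
  by_cases hM1 : 1 ≤ M
  swap
  -- For M < 1 no system satisfies the hypotheses, so any polynomials work.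
  · refine ⟨1, 0, 0, fun y _ => by simp, fun d k N hd hk S K hB hA hC hQ hμ L hL => ?_⟩
    exact absurd (MJLS.bounded_of_le hd hM hB hA hC hQ hμ hL).one_le hM1
  -- The exponent p converts growth by 8M² per step into a power of 1/η.
  obtain ⟨p, hp⟩ := exists_pow_lt_of_lt_one (show 0 < 1 / (8 * M ^ 2) by positivity)
    (mjlsRate_lt_one hM1)
  have hp' : 8 * M ^ 2 * mjlsRate M ^ p ≤ 1 := by
    rw [lt_div_iff₀ (by positivity)] at hp
    linarith
  obtain ⟨D, hD⟩ := exists_nat_ge (M ^ 3)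
  -- A polynomial in 1/ε only. The variable for d occurs in none of the witnesses, because D absorbs
  -- the dimension.
  let W : Polynomial ℝ := Polynomial.C (8 * M ^ 2) *
    (Polynomial.C (24 * M ^ 8 * D ^ (D + 2)) * Polynomial.X ^ (D + 1)) ^ p + 1
  refine ⟨Polynomial.C (12 * D ^ 2 * M ^ 2) * W * Polynomial.X + Polynomial.C (4 * M ^ 6),
    Polynomial.aeval (MvPolynomial.X 1) W,
    MvPolynomial.C (18 * D ^ 6 * M ^ 4) * Polynomial.aeval (MvPolynomial.X 1) W ^ 2 *
      MvPolynomial.X 2 ^ 2 * MvPolynomial.X 1 ^ 2 *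
      (MvPolynomial.C (D : ℝ) * MvPolynomial.X 1) ^ D + 1, ?_, ?_⟩
  · intro y hy
    simp only [W, Polynomial.eval_add, Polynomial.eval_mul, Polynomial.eval_C, Polynomial.eval_X,
      Polynomial.eval_pow, Polynomial.eval_one]
    positivity
  · intro d k N hd hk S K hB hA hC hQ hμ L hL ε hε r hr0 hr l hl m hm
    have h := MJLS.bounded_of_le hd hM hB hA hC hQ hμ hL
    have hWe : ∀ {n : ℕ} (v : Fin n → ℝ) (q : MvPolynomial (Fin n) ℝ),
        MvPolynomial.eval v (Polynomial.aeval q W) = W.eval (MvPolynomial.eval v q) := by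
      intro n v q
      simp [W]
    refine h.le_measure_of_rates (W := W.eval (1 / ε)) hd hk hL hD hp' hε hr0 ?_ ?_ ?_ ?_
    · simp [W]
    · simpa using hr
    · simpa [hWe] using hl
    · simpa [hWe] using hm
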